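/- Let $\Omega$ be a compact metric space with its Borel $\sigma$-algebra and let $\mu_0\neq\mu_1$ be two mutually absolutely continuous probability measures on $\Omega$. Model. Let $G=(V,E)$ be a connected undirected simple graph with finitely or countably many vertices (agents), all of finite degree. The state of the world $S$ is uniform on $\{0,1\}$ and, conditionally on $S$, the private signals $W_i\in\Omega$, $i\in V$, are i.i.d. with law $\mu_S$; write $\mathbb P$ for the law of $(S,(W_i)_{i\in V})$. Let $N(i)$ consist of $i$ and its neighbours. At times $t=0,1,2,\dots$ every agent $i$ takes an action $A^i_t\in\{0,1\}$ on the basis of the information $H^i_t=\{W_i,\ A^j_{t'} : j\in N(i),\ t'<t\}$, namely $$A^i_t=\operatorname{argmax}_{s\in\{0,1\}}\ \mathbb P(S=s\mid H^i_t).$$ If both values of $s$ are equally likely, then the action is chosen by a deterministic measurable rule $\tau$, fixed once and for all, which is the same for all agents and all graphs and is a function of $W_i$, of the past actions of $i$, and of the multiset of the past action sequences of the neighbours of $i$. The limit action set $A^i_\infty\subseteq\{0,1\}$ is the set of accumulation points of $(A^i_t)_{t\ge 0}$. A random set $A_\infty\subseteq\{0,1\}$ is called a common limit action set on $G$ if almost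 surely $A^i_\infty=A_\infty$ for all $i\in V$. Theorem. Suppose that, for the given $\mu_0,\mu_1$ and $\tau$, there is a common limit action set on every connected undirected graph $G$ as above, finite or infinite. Then there is a sequence $q(n)\to 1$ (as $n\to\infty$), depending only on $\mu_0$ and $\mu_1$ (and on the fixed rule $\tau$), such that for every $n$ and every connected undirected graph $G$ with $n$ agents the common limit action set $A_\infty$ satisfies $$\mathbb P\big(A_\infty=\{S\}\big)\ \ge\ q(n).$$ -/

import Mathlib

open MeasureTheory Filter Topology

namespace SocialLearning

/-- A configuration of the world: the state `S` of the world (`false` is `0`, `true` is `1`) together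
with the private signal of every agent. -/
abbrev World (V Ω : Type*) : Type _ := Bool × (V → Ω)

/-- The state of the world is uniform on `{0, 1}` and, given that it is `s`, the private signals are
i.i.d. with law `μ_s`. -/
noncomputable def law (V : Type*) {Ω : Type*} [MeasurableSpace Ω] (μ₀ μ₁ : Measure Ω)
    [IsProbabilityMeasure μ₀] [IsProbabilityMeasure μ₁] : Measure (World V Ω) :=
  (1 / 2 : ENNReal) • (Measure.dirac false).prod (Measure.infinitePi fun _ : V => μ₀) +
    (1 / 2 : ENNReal) • (Measure.dirac true).prod (Measure.infinitePi fun _ : V => μ₁)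

/-- A deterministic rule that selects an action in case of indifference. It is the same for all
agents and all graphs, and may use everything that an agent knows: its private signal, its own past
actions, and the past action sequences of its neighbours (with multiplicity, without their names).
The time is the length of these sequences. -/
structure TieRule (Ω : Type*) [MeasurableSpace Ω] where
  choose : Ω → List Bool → Multiset (List Bool) → Bool
  measurable_choose : ∀ own nbrs, Measurable fun x => choose x own nbrs

section Dynamics

variable {V : Type*} {Ω : Type*} [MeasurableSpace Ω]

/-- The σ-algebra of agent `i`'s information: its private signal and the past action sequences of
the agents that it observes, namely itself and its neighbours in `G`. -/
@[reducible] def info (G : SimpleGraph V) (past : V → World V Ω → List Bool) (i : V) :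
    MeasurableSpace (World V Ω) :=
  MeasurableSpace.comap (fun ω : World V Ω => ω.2 i) inferInstance ⊔
    ⨆ j ∈ insert i (G.neighborSet i), MeasurableSpace.comap (past j) ⊤

variable (μ₀ μ₁ : Measure Ω) [IsProbabilityMeasure μ₀] [IsProbabilityMeasure μ₁]

/-- The conditional probability of `S = 1` given the information of agent `i`. -/
noncomputable def belief (G : SimpleGraph V) (past : V → World V Ω → List Bool) (i : V) :
    World V Ω → ℝ :=
  (law V μ₀ μ₁)[Set.indicator {ω : World V Ω | ω.1 = true} (fun _ => (1 : ℝ)) | info G past i]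

open scoped Classical in
/-- The myopic Bayesian choice of agent `i`: the more likely state of the world given its
information, and the choice of the tie rule in case both are equally likely. -/
noncomputable def bestAction (τ : TieRule Ω) (G : SimpleGraph V) [G.LocallyFinite]
    (past : V → World V Ω → List Bool) (i : V) (ω : World V Ω) : Bool :=
  if 1 / 2 < belief μ₀ μ₁ G past i ω then true
  else if belief μ₀ μ₁ G past i ω < 1 / 2 then false
  else τ.choose (ω.2 i) (past i ω) ((G.neighborFinset i).val.map fun j => past j ω)

/-- `history t i` is the sequence `(A^i_0, …, A^i_{t-1})` of the actions of agent `i` before time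
`t`. -/
noncomputable def history (τ : TieRule Ω) (G : SimpleGraph V) [G.LocallyFinite] :
    ℕ → V → World V Ω → List Bool
  | 0 => fun _ _ => []
  | t + 1 => fun i ω =>
      history τ G t i ω ++ [bestAction μ₀ μ₁ τ G (history τ G t) i ω]

/-- The action `A^i_t` of agent `i` at time `t`. -/
noncomputable def action (τ : TieRule Ω) (G : SimpleGraph V) [G.LocallyFinite]
    (t : ℕ) (i : V) (ω : World V Ω) : Bool :=
  bestAction μ₀ μ₁ τ G (history μ₀ μ₁ τ G t) i ω

/-- The limit action set `A^i_∞` of agent `i`: the accumulation points of its actions. -/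
def limitActions (τ : TieRule Ω) (G : SimpleGraph V) [G.LocallyFinite]
    (i : V) (ω : World V Ω) : Set Bool :=
  {a | MapClusterPt a atTop fun t : ℕ => action μ₀ μ₁ τ G t i ω}

/-- The random set `A` is almost surely equal to the limit action set of every agent. -/
def IsCommonLimit (τ : TieRule Ω) (G : SimpleGraph V) [G.LocallyFinite]
    (A : World V Ω → Set Bool) : Prop :=
  Measurable A ∧ ∀ᵐ ω ∂(law V μ₀ μ₁), ∀ i, limitActions μ₀ μ₁ τ G i ω = A ω

/-- On every connected undirected graph with countably many agents and finite degrees, the agents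
reach a common limit action set. -/
def GuaranteesAgreement (τ : TieRule Ω) : Prop :=
  ∀ (V : Type) [Countable V] (G : SimpleGraph V) [G.LocallyFinite], G.Connected →
    ∃ A : World V Ω → Set Bool, IsCommonLimit μ₀ μ₁ τ G A

end Dynamics

end SocialLearning

/-! Large degrees and long distances each give access to many nearly independent pieces of
information, and the common limit must be at least as good as either.

High degree. The first actions of the neighbours are conditionally independent, and each separates
the two states by a fixed gap depending only on `μ₀` and `μ₁`. By Chebyshev's inequality, an agent
of large degree identifies the state with small error, and its limit action set inherits this up to
a factor 2 (`IsCommonLimit.one_sub_law_real_le_of_degree`). Hence a sequence of growing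
counterexamples has bounded degree.

Compactness. Actions up to a fixed time depend only on a finite neighbourhood, so their laws pass to
local limits. A rooted sequence of growing connected graphs of bounded degree has an infinite
connected local limit, namely the component of the root in an ultraproduct (`exists_isLocalLimit`).
On an infinite graph the agents settle almost surely on one action (`IsCommonLimit.law_undecided`),
and the probability of correctness is lower semicontinuous (`IsLocalLimit.law_real_le`). It
therefore suffices that infinite graphs of bounded degree are correct with probability 1
(`eq_one_of_mem_correctProbabilities`).

Infinite graphs. By compactness the infimum of the correctness probabilities at a given degree bound
is attained, on some `G'`. Suppose that it is below 1, and let `G''` be a local limit of `G'` around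
vertices escaping to infinity. Given the state, the common limit of `G'` is asymptotically
independent of what happens around such vertices (`tendsto_infinitePi_real_inter`). An agent there
knows the common limit and also sees approximately the outcome on `G''`, yet still finds the common
limit optimal. This makes `G'` at least as accurate as `G''`; a further independent signal excludes
equality (`IsCommonLimit.law_real_lt`). So `G''` beats the infimum from below, a contradiction. -/

namespace SocialLearning

open ProbabilityTheory

/-! ### The joint law of state and signals, and its restriction to subsets of agents -/

section Law

variable {Ω : Type*} [MeasurableSpace Ω] (μ₀ μ₁ : Measure Ω)

/-- The law of a private signal in state `s`. -/
noncomputable def signalLaw (s : Bool) : Measure Ω := if s then μ₁ else μ₀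

@[simp] lemma signalLaw_false : signalLaw μ₀ μ₁ false = μ₀ := rfl

@[simp] lemma signalLaw_true : signalLaw μ₀ μ₁ true = μ₁ := rfl

variable [IsProbabilityMeasure μ₀] [IsProbabilityMeasure μ₁]

instance (s : Bool) : IsProbabilityMeasure (signalLaw μ₀ μ₁ s) := by
  cases s <;> simpa

/-- The joint law of the private signals in state `s`. -/
noncomputable def signalsLaw (V : Type*) (s : Bool) : Measure (V → Ω) :=
  Measure.infinitePi fun _ : V => signalLaw μ₀ μ₁ s

instance (V : Type*) (s : Bool) : IsProbabilityMeasure (signalsLaw μ₀ μ₁ V s) := by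
  unfold signalsLaw; infer_instance

lemma law_apply (V : Type*) {E : Set (World V Ω)} (hE : MeasurableSet E) :
    law V μ₀ μ₁ E = 1 / 2 * signalsLaw μ₀ μ₁ V false (Prod.mk false ⁻¹' E) +
      1 / 2 * signalsLaw μ₀ μ₁ V true (Prod.mk true ⁻¹' E) := by
  simp only [law, Measure.add_apply, Measure.smul_apply, smul_eq_mul, signalsLaw,
    signalLaw_false, signalLaw_true]
  rw [Measure.dirac_prod, Measure.dirac_prod, Measure.map_apply measurable_prodMk_left hE,
    Measure.map_apply measurable_prodMk_left hE]

instance (V : Type*) : IsProbabilityMeasure (law V μ₀ μ₁) := by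
  refine ⟨?_⟩
  rw [law_apply μ₀ μ₁ V .univ]
  simp [ENNReal.inv_two_add_inv_two]

lemma measurableSet_state {V : Type*} (s : Bool) : MeasurableSet {ω : World V Ω | ω.1 = s} :=
  measurable_fst (measurableSet_singleton s)

lemma law_real_inter_state (V : Type*) {E : Set (World V Ω)} (hE : MeasurableSet E) (s : Bool) :
    (law V μ₀ μ₁).real (E ∩ {ω | ω.1 = s}) =
      1 / 2 * (signalsLaw μ₀ μ₁ V s).real (Prod.mk s ⁻¹' E) := by
  rw [measureReal_def, law_apply μ₀ μ₁ V (hE.inter (measurableSet_state s))]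
  cases s <;> simp [measureReal_def, Set.preimage]

lemma law_real_eq_add (V : Type*) (E : Set (World V Ω)) (s : Bool) :
    (law V μ₀ μ₁).real E = (law V μ₀ μ₁).real (E ∩ {ω | ω.1 = s}) +
      (law V μ₀ μ₁).real (E ∩ {ω | ω.1 = !s}) := by
  rw [← measureReal_inter_add_sdiff (measurableSet_state s)]
  congr 2
  ext ω
  cases h : ω.1 <;> cases s <;> simp [h]

/-- The restriction of a world on `V` to the agents in the range of `e`. -/
def pull {V K : Type*} (e : K → V) (ω : World V Ω) : World K Ω := (ω.1, fun k => ω.2 (e k))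

lemma measurable_pull {V K : Type*} (e : K → V) : Measurable (pull (Ω := Ω) e) := by
  unfold pull; fun_prop

lemma measurePreserving_comp_signals {V K : Type*} {e : K → V} (he : e.Injective) (s : Bool) :
    MeasurePreserving (fun (w : V → Ω) k => w (e k)) (signalsLaw μ₀ μ₁ V s)
      (signalsLaw μ₀ μ₁ K s) :=
  ⟨by fun_prop, Measure.map_infinitePi_infinitePi_of_inj
    (P := fun _ : V => signalLaw μ₀ μ₁ s) he⟩

lemma measurePreserving_pull {V K : Type*} {e : K → V} (he : e.Injective) :
    MeasurePreserving (pull e) (law V μ₀ μ₁) (law K μ₀ μ₁) := by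
  refine ⟨measurable_pull e, ?_⟩
  ext E hE
  have h (s : Bool) := (measurePreserving_comp_signals μ₀ μ₁ he s).measure_preimage
    (measurable_prodMk_left hE : MeasurableSet (Prod.mk s ⁻¹' E)).nullMeasurableSet
  rw [Measure.map_apply (measurable_pull e) hE, law_apply μ₀ μ₁ K hE, ← h, ← h,
    law_apply μ₀ μ₁ V (measurable_pull e hE)]
  rfl

end Law

/-! ### Information of the agents and measurability of their actions -/

section Measurability

instance : MeasurableSpace (List Bool) := ⊤

instance : DiscreteMeasurableSpace (List Bool) := ⟨fun _ => trivial⟩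

variable {V : Type*} {Ω : Type*} [MeasurableSpace Ω]

/-- What an agent `i` observes, when the agents in its closed neighbourhood are the values of
`k`. -/
def observation {J : Type*} (past : V → World V Ω → List Bool) (i : V) (k : J → V)
    (ω : World V Ω) : Ω × (J → List Bool) :=
  (ω.2 i, fun c => past (k c) ω)

lemma measurable_observation {J : Type*} {past : V → World V Ω → List Bool}
    (hpast : ∀ j, Measurable (past j)) (i : V) (k : J → V) :
    Measurable (observation past i k) := by
  unfold observation; fun_prop

lemma info_eq_comap {G : SimpleGraph V} (past : V → World V Ω → List Bool) {i : V}
    {J : Type*} {k : J → V} (hk : Set.range k = insert i (G.neighborSet i)) :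
    info G past i = MeasurableSpace.comap (observation past i k) inferInstance := by
  unfold info observation
  rw [← hk, iSup_range]
  have h := MeasurableSpace.comap_prodMk (mβ := ‹MeasurableSpace Ω›)
    (mγ := (inferInstance : MeasurableSpace (J → List Bool)))
    (fun ω : World V Ω => ω.2 i) (fun ω c => past (k c) ω)
  refine Eq.trans ?_ h.symm
  congr 1
  change _ = MeasurableSpace.comap _ (⨆ c, MeasurableSpace.comap (fun b : J → List Bool => b c) ⊤)
  simp only [MeasurableSpace.comap_iSup, MeasurableSpace.comap_comp]
  rfl

lemma info_le {G : SimpleGraph V} {past : V → World V Ω → List Bool}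
    (hpast : ∀ j, Measurable (past j)) (i : V) :
    info G past i ≤ (Prod.instMeasurableSpace : MeasurableSpace (World V Ω)) := by
  refine sup_le (Measurable.comap_le ?_) (iSup₂_le fun j _ => (hpast j).comap_le)
  fun_prop

lemma measurable_signal_info (G : SimpleGraph V) (past : V → World V Ω → List Bool) (i : V) :
    Measurable[info G past i] fun ω : World V Ω => ω.2 i :=
  Measurable.mono (comap_measurable _) le_sup_left le_rfl

lemma measurable_past_info {G : SimpleGraph V} (past : V → World V Ω → List Bool) {i j : V}
    (hj : j ∈ insert i (G.neighborSet i)) : Measurable[info G past i] (past j) :=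
  Measurable.mono (comap_measurable (past j))
    (le_sup_of_le_right (le_iSup₂_of_le j hj le_rfl)) le_rfl

variable (μ₀ μ₁ : Measure Ω) [IsProbabilityMeasure μ₀] [IsProbabilityMeasure μ₁]

lemma measurable_tieBreak (τ : TieRule Ω) (G : SimpleGraph V) [G.LocallyFinite]
    (past : V → World V Ω → List Bool) (i : V) :
    Measurable[info G past i] fun ω =>
      τ.choose (ω.2 i) (past i ω) ((G.neighborFinset i).val.map fun j => past j ω) := by
  classical
  let J := {j // j ∈ insert i (G.neighborFinset i)}
  let f : J → V := Subtype.val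
  have hf : Set.range f = insert i (G.neighborSet i) := by
    ext j; simp [f, J]
  have hi : i ∈ insert i (G.neighborFinset i) := Finset.mem_insert_self _ _
  let nbrs : (J → List Bool) → Multiset (List Bool) := fun y =>
    (G.neighborFinset i).val.map fun j =>
      if h : j ∈ insert i (G.neighborFinset i) then y ⟨j, h⟩ else []
  let F : Ω × (J → List Bool) → Bool := fun p => τ.choose p.1 (p.2 ⟨i, hi⟩) (nbrs p.2)
  -- The finitely many observed histories take only countably many joint values, so measurability in
  -- the signal for each fixed value suffices.
  have hF : Measurable F := measurable_from_prod_countable_left fun y =>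
    τ.measurable_choose (y ⟨i, hi⟩) (nbrs y)
  rw [info_eq_comap past hf]
  convert hF.comp (comap_measurable (observation past i f)) using 2 with ω
  simp only [F, nbrs, observation, f, Function.comp_apply]
  congr 1
  refine Multiset.map_congr rfl fun j hj => ?_
  rw [dif_pos (Finset.mem_insert_of_mem hj)]

lemma measurable_belief (G : SimpleGraph V) (past : V → World V Ω → List Bool) (i : V) :
    Measurable[info G past i] (belief μ₀ μ₁ G past i) :=
  stronglyMeasurable_condExp.measurable

lemma measurable_bestAction (τ : TieRule Ω) (G : SimpleGraph V) [G.LocallyFinite]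
    (past : V → World V Ω → List Bool) (i : V) :
    Measurable[info G past i] (bestAction μ₀ μ₁ τ G past i) := by
  have hb := measurable_belief μ₀ μ₁ G past i
  unfold bestAction
  refine Measurable.ite (measurableSet_lt measurable_const hb) measurable_const ?_
  exact Measurable.ite (measurableSet_lt hb measurable_const) measurable_const
    (measurable_tieBreak τ G past i)

variable (τ : TieRule Ω) (G : SimpleGraph V) [G.LocallyFinite]

lemma history_succ (t : ℕ) (i : V) (ω : World V Ω) : history μ₀ μ₁ τ G (t + 1) i ω =
    history μ₀ μ₁ τ G t i ω ++ [action μ₀ μ₁ τ G t i ω] := rfl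

lemma measurable_history (t : ℕ) (i : V) : Measurable (history μ₀ μ₁ τ G t i) := by
  induction t generalizing i with
  | zero => exact measurable_const
  | succ t ih =>
    have h := (measurable_bestAction μ₀ μ₁ τ G (history μ₀ μ₁ τ G t) i).mono (info_le ih i) le_rfl
    exact (Measurable.of_discrete (f := fun p : List Bool × Bool => p.1 ++ [p.2])).comp
      ((ih i).prodMk h)

/-- The information of agent `i` as time goes by. -/
noncomputable def infoFiltration (i : V) :
    Filtration ℕ (Prod.instMeasurableSpace : MeasurableSpace (World V Ω)) where
  seq t := info G (history μ₀ μ₁ τ G t) i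
  mono' := by
    refine monotone_nat_of_le_succ fun t => sup_le le_sup_left (iSup₂_le fun j hj => ?_)
    refine Measurable.comap_le (?_ : Measurable[info G (history μ₀ μ₁ τ G (t + 1)) i] _)
    -- A longer history determines the shorter one, so information only grows.
    have h := (Measurable.of_discrete (f := List.dropLast (α := Bool))).comp
      (measurable_past_info (history μ₀ μ₁ τ G (t + 1)) hj)
    have h' : List.dropLast ∘ history μ₀ μ₁ τ G (t + 1) j = history μ₀ μ₁ τ G t j :=
      funext fun ω => by simp [history_succ]
    rwa [h'] at h
  le' t := info_le (measurable_history μ₀ μ₁ τ G t) i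

/-- All the information that agent `i` ever gets. -/
@[reducible] noncomputable def limitInfo (i : V) : MeasurableSpace (World V Ω) :=
  ⨆ t, infoFiltration μ₀ μ₁ τ G i t

lemma limitInfo_le (i : V) : limitInfo μ₀ μ₁ τ G i ≤ (Prod.instMeasurableSpace : MeasurableSpace (World V Ω)) :=
  iSup_le fun t => (infoFiltration μ₀ μ₁ τ G i).le t

lemma measurable_history_limitInfo (t : ℕ) {i j : V} (hj : j ∈ insert i (G.neighborSet i)) :
    Measurable[limitInfo μ₀ μ₁ τ G i] (history μ₀ μ₁ τ G t j) :=
  (measurable_past_info (history μ₀ μ₁ τ G t) hj).mono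
    (le_iSup (fun t => infoFiltration μ₀ μ₁ τ G i t) t) le_rfl

lemma action_eq_getLast (t : ℕ) (i : V) (ω : World V Ω) :
    action μ₀ μ₁ τ G t i ω = (history μ₀ μ₁ τ G (t + 1) i ω).getLastD false := by
  simp [history_succ]

lemma measurable_action_limitInfo (t : ℕ) {i j : V} (hj : j ∈ insert i (G.neighborSet i)) :
    Measurable[limitInfo μ₀ μ₁ τ G i] (action μ₀ μ₁ τ G t j) := by
  have h := (Measurable.of_discrete (f := fun l : List Bool => l.getLastD false)).comp
    (measurable_history_limitInfo μ₀ μ₁ τ G (t + 1) hj)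
  have h' : (fun l : List Bool => l.getLastD false) ∘ history μ₀ μ₁ τ G (t + 1) j =
      action μ₀ μ₁ τ G t j := funext fun ω => (action_eq_getLast μ₀ μ₁ τ G t j ω).symm
  rwa [h'] at h

lemma measurable_action (t : ℕ) (i : V) : Measurable (action μ₀ μ₁ τ G t i) :=
  (measurable_action_limitInfo μ₀ μ₁ τ G t (Set.mem_insert i _)).mono
    (limitInfo_le μ₀ μ₁ τ G i) le_rfl

lemma measurable_signal_limitInfo (i : V) :
    Measurable[limitInfo μ₀ μ₁ τ G i] fun ω : World V Ω => ω.2 i :=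
  (measurable_signal_info G _ i).mono (le_iSup (fun t => infoFiltration μ₀ μ₁ τ G i t) 0) le_rfl

end Measurability

/-! ### Optimality of actions and of their accumulation points -/

section Optimality

variable {V : Type*} {Ω : Type*} [MeasurableSpace Ω]
variable (μ₀ μ₁ : Measure Ω) [IsProbabilityMeasure μ₀] [IsProbabilityMeasure μ₁]

lemma setIntegral_condExp_state {m : MeasurableSpace (World V Ω)}
    (hm : m ≤ (Prod.instMeasurableSpace : MeasurableSpace (World V Ω))) {D : Set (World V Ω)}
    (hD : MeasurableSet[m] D) :
    ∫ ω in D, (law V μ₀ μ₁)[Set.indicator {ω : World V Ω | ω.1 = true} (fun _ => (1 : ℝ)) | m] ω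
      ∂(law V μ₀ μ₁) = (law V μ₀ μ₁).real (D ∩ {ω | ω.1 = true}) := by
  rw [setIntegral_condExp hm ((integrable_const 1).indicator (measurableSet_state true)) hD,
    setIntegral_indicator (measurableSet_state true)]
  simp

/-- On an event of `m` on which the posterior of one state is at least one half, this state is the
more likely one. -/
lemma law_real_inter_state_le_of_condExp {m : MeasurableSpace (World V Ω)}
    (hm : m ≤ (Prod.instMeasurableSpace : MeasurableSpace (World V Ω))) {D : Set (World V Ω)}
    (hD : MeasurableSet[m] D) (a : Bool)
    (h : ∀ᵐ ω ∂(law V μ₀ μ₁), ω ∈ D → if a then 1 / 2 ≤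
      ((law V μ₀ μ₁)[Set.indicator {ω : World V Ω | ω.1 = true} (fun _ => (1 : ℝ)) | m]) ω
      else ((law V μ₀ μ₁)[Set.indicator {ω : World V Ω | ω.1 = true} (fun _ => (1 : ℝ)) | m]) ω
        ≤ 1 / 2) :
    (law V μ₀ μ₁).real (D ∩ {ω | ω.1 = !a}) ≤ (law V μ₀ μ₁).real (D ∩ {ω | ω.1 = a}) := by
  have hI := setIntegral_condExp_state μ₀ μ₁ hm hD
  have hc : ∫ _ in D, (1 / 2 : ℝ) ∂(law V μ₀ μ₁) = 1 / 2 * (law V μ₀ μ₁).real D := by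
    simp [mul_comm]
  have hadd := law_real_eq_add μ₀ μ₁ V D true
  have hint : Integrable ((law V μ₀ μ₁)[Set.indicator {ω : World V Ω | ω.1 = true}
    (fun _ => (1 : ℝ)) | m]) (law V μ₀ μ₁) := integrable_condExp
  cases a
  · have := setIntegral_mono_on_ae hint.integrableOn (integrable_const (1 / 2 : ℝ)).integrableOn
      (hm D hD) (by simpa using h)
    simp only [Bool.not_true, Bool.not_false] at *
    linarith
  · have := setIntegral_mono_on_ae (integrable_const (1 / 2 : ℝ)).integrableOn hint.integrableOn
      (hm D hD) (by simpa using h)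
    simp only [Bool.not_true] at *
    linarith

variable (τ : TieRule Ω) (G : SimpleGraph V) [G.LocallyFinite]

lemma half_le_belief_of_action {t : ℕ} {i : V} {ω : World V Ω} {a : Bool}
    (h : action μ₀ μ₁ τ G t i ω = a) : if a then 1 / 2 ≤ belief μ₀ μ₁ G (history μ₀ μ₁ τ G t) i ω
      else belief μ₀ μ₁ G (history μ₀ μ₁ τ G t) i ω ≤ 1 / 2 := by
  unfold action bestAction at h
  split_ifs at h
  · subst h
    exact (by assumption : _ < _).le
  · subst h
    exact (by assumption : _ < (1 / 2 : ℝ)).le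
  · cases a <;> simp_all only [not_lt, Bool.false_eq_true, if_false, if_true]

/-- The actions are myopically optimal. -/
lemma law_real_action_le (t : ℕ) (i : V) {D : Set (World V Ω)}
    (hD : MeasurableSet[info G (history μ₀ μ₁ τ G t) i] D) (a : Bool) :
    (law V μ₀ μ₁).real (D ∩ {ω | action μ₀ μ₁ τ G t i ω = a} ∩ {ω | ω.1 = !a}) ≤
      (law V μ₀ μ₁).real (D ∩ {ω | action μ₀ μ₁ τ G t i ω = a} ∩ {ω | ω.1 = a}) := by
  have hA : MeasurableSet[info G (history μ₀ μ₁ τ G t) i] {ω | action μ₀ μ₁ τ G t i ω = a} :=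
    measurable_bestAction μ₀ μ₁ τ G (history μ₀ μ₁ τ G t) i (measurableSet_singleton a)
  refine law_real_inter_state_le_of_condExp μ₀ μ₁ (info_le (measurable_history μ₀ μ₁ τ G t) i)
    (hD.inter hA) a (Eventually.of_forall fun ω hω => ?_)
  exact half_le_belief_of_action μ₀ μ₁ τ G hω.2

lemma one_sub_law_real_action (t : ℕ) (i : V) :
    1 - (law V μ₀ μ₁).real {ω | action μ₀ μ₁ τ G t i ω = ω.1} =
      (law V μ₀ μ₁).real ({ω | action μ₀ μ₁ τ G t i ω = true} ∩ {ω | ω.1 = false}) +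
      (law V μ₀ μ₁).real ({ω | action μ₀ μ₁ τ G t i ω = true}ᶜ ∩ {ω | ω.1 = true}) := by
  have hact : MeasurableSet {ω : World V Ω | action μ₀ μ₁ τ G t i ω = ω.1} :=
    measurableSet_eq_fun (measurable_action μ₀ μ₁ τ G t i) measurable_fst
  rw [← probReal_compl_eq_one_sub (μ := law V μ₀ μ₁) hact, law_real_eq_add μ₀ μ₁ V _ false]
  congr 2 <;> ext ω <;> simp only [Set.mem_inter_iff, Set.mem_compl_iff, Set.mem_ofPred_eq] <;>
    cases ω.1 <;> simp

lemma mem_limitActions {i : V} {ω : World V Ω} {a : Bool} :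
    a ∈ limitActions μ₀ μ₁ τ G i ω ↔ ∃ᶠ t in atTop, action μ₀ μ₁ τ G t i ω = a := by
  simp only [limitActions, Set.mem_ofPred_eq, mapClusterPt_iff_frequently, nhds_discrete,
    mem_pure]
  exact ⟨fun h => h {a} rfl, fun h s hs => h.mono fun t ht => by rwa [ht]⟩

lemma exists_mem_limitActions (i : V) (ω : World V Ω) (a : Bool) :
    a ∈ limitActions μ₀ μ₁ τ G i ω ∨ (!a) ∈ limitActions μ₀ μ₁ τ G i ω := by
  rw [mem_limitActions, mem_limitActions, ← frequently_or_distrib]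
  exact Frequently.of_forall fun t => by
    cases action μ₀ μ₁ τ G t i ω <;> cases a <;> simp

lemma measurableSet_mem_limitActions (i : V) (a : Bool) :
    MeasurableSet[limitInfo μ₀ μ₁ τ G i] {ω | a ∈ limitActions μ₀ μ₁ τ G i ω} := by
  have : {ω | a ∈ limitActions μ₀ μ₁ τ G i ω} =
      ⋂ n : ℕ, ⋃ t : ℕ, ⋃ _ : n ≤ t, {ω | action μ₀ μ₁ τ G t i ω = a} := by
    ext ω
    simp [mem_limitActions, frequently_atTop]
  rw [this]
  refine MeasurableSet.iInter fun n => MeasurableSet.iUnion fun t => MeasurableSet.iUnion fun _ => ?_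
  exact measurable_action_limitInfo μ₀ μ₁ τ G t (Set.mem_insert i _) (measurableSet_singleton a)

/-- An action that is taken infinitely often is optimal given all the information that the agent
ever gets. -/
lemma law_real_limitActions_le (i : V) {D : Set (World V Ω)}
    (hD : MeasurableSet[limitInfo μ₀ μ₁ τ G i] D) (a : Bool) :
    (law V μ₀ μ₁).real (D ∩ {ω | a ∈ limitActions μ₀ μ₁ τ G i ω} ∩ {ω | ω.1 = !a}) ≤
      (law V μ₀ μ₁).real (D ∩ {ω | a ∈ limitActions μ₀ μ₁ τ G i ω} ∩ {ω | ω.1 = a}) := by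
  refine law_real_inter_state_le_of_condExp μ₀ μ₁ (limitInfo_le μ₀ μ₁ τ G i)
    (hD.inter (measurableSet_mem_limitActions μ₀ μ₁ τ G i a)) a ?_
  -- Lévy's upward theorem: beliefs converge to the posterior given `limitInfo`. An action taken
  -- infinitely often keeps the belief on its side of 1/2 infinitely often, and the closed
  -- inequality survives the limit.
  filter_upwards [tendsto_ae_condExp (ℱ := infoFiltration μ₀ μ₁ τ G i) (μ := law V μ₀ μ₁)
    (Set.indicator {ω : World V Ω | ω.1 = true} (fun _ => (1 : ℝ)))] with ω hω hmem
  have hfreq := ((mem_limitActions μ₀ μ₁ τ G).1 hmem.2).mono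
    fun t ht => half_le_belief_of_action μ₀ μ₁ τ G ht
  cases a <;> simp only [Bool.false_eq_true, if_false, if_true] at hfreq ⊢
  · exact le_of_tendsto_of_frequently hω hfreq
  · exact ge_of_tendsto_of_frequently hω hfreq

end Optimality

/-! ### Accuracy of the common limit compared with other tests -/

section CommonLimit

variable {V : Type*} {Ω : Type*} [MeasurableSpace Ω]
variable {μ₀ μ₁ : Measure Ω} [IsProbabilityMeasure μ₀] [IsProbabilityMeasure μ₁]
variable {τ : TieRule Ω} {G : SimpleGraph V} [G.LocallyFinite] {A : World V Ω → Set Bool}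

lemma IsCommonLimit.measurableSet (hA : IsCommonLimit μ₀ μ₁ τ G A) (a : Bool) :
    MeasurableSet {ω | a ∈ A ω} :=
  measurableSet_setOfPred.2 (measurable_set_iff.1 hA.1 a)

lemma IsCommonLimit.measurableSet_eq_state (hA : IsCommonLimit μ₀ μ₁ τ G A) :
    MeasurableSet {ω | A ω = {ω.1}} := by
  have : {ω | A ω = {ω.1}} = ⋃ s : Bool, ({ω : World V Ω | ω.1 = s} ∩
      ({ω | s ∈ A ω} ∩ {ω | (!s) ∈ A ω}ᶜ)) := by
    ext ω
    simp only [Set.mem_ofPred_eq, Set.ext_iff, Bool.forall_bool, Set.mem_iUnion, Set.mem_inter_iff,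
      Bool.exists_bool, Set.mem_compl_iff, Set.mem_singleton_iff]
    cases ω.1 <;> simp [and_comm]
  rw [this]
  exact MeasurableSet.iUnion fun s => (measurableSet_state s).inter
    ((hA.measurableSet s).inter (hA.measurableSet !s).compl)

lemma IsCommonLimit.law_real_le (hA : IsCommonLimit μ₀ μ₁ τ G A) (i : V) {D : Set (World V Ω)}
    (hD : MeasurableSet[limitInfo μ₀ μ₁ τ G i] D) (a : Bool) :
    (law V μ₀ μ₁).real (D ∩ {ω | a ∈ A ω} ∩ {ω | ω.1 = !a}) ≤
      (law V μ₀ μ₁).real (D ∩ {ω | a ∈ A ω} ∩ {ω | ω.1 = a}) := by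
  have h (s : Bool) : (law V μ₀ μ₁).real (D ∩ {ω | a ∈ A ω} ∩ {ω | ω.1 = s}) =
      (law V μ₀ μ₁).real (D ∩ {ω | a ∈ limitActions μ₀ μ₁ τ G i ω} ∩ {ω | ω.1 = s}) := by
    refine measureReal_congr ?_
    filter_upwards [hA.2] with ω hω
    refine propext ?_
    change (_ ∧ a ∈ A ω) ∧ _ ↔ (_ ∧ a ∈ limitActions μ₀ μ₁ τ G i ω) ∧ _
    rw [hω i]
  rw [h, h]
  exact law_real_limitActions_le μ₀ μ₁ τ G i hD a

/-- The probability that the wrong action is among the accumulation points, split according to an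
event `D`. -/
lemma IsCommonLimit.law_real_wrong_le (hA : IsCommonLimit μ₀ μ₁ τ G A) (i : V)
    {D : Set (World V Ω)} (hD : MeasurableSet[limitInfo μ₀ μ₁ τ G i] D) (a : Bool) :
    (law V μ₀ μ₁).real ({ω | a ∈ A ω} ∩ {ω | ω.1 = !a}) ≤
      (law V μ₀ μ₁).real (D ∩ {ω | ω.1 = !a} ∩ {ω | a ∈ A ω}) +
      (law V μ₀ μ₁).real (Dᶜ ∩ {ω | ω.1 = a} ∩ {ω | a ∈ A ω}) := by
  -- `D` plays the role of a test for `a`. Off `D`, optimality replaces the wrong state by the right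
  -- one, turning this mass into an error of the test.
  have h := hA.law_real_le i hD.compl a
  have hD' : MeasurableSet D := limitInfo_le μ₀ μ₁ τ G i D hD
  rw [← measureReal_inter_add_sdiff hD']
  refine add_le_add (measureReal_mono fun ω hω => ⟨⟨hω.2, hω.1.2⟩, hω.1.1⟩) (le_trans ?_ (h.trans ?_))
  · exact measureReal_mono fun ω hω => ⟨⟨hω.2, hω.1.1⟩, hω.1.2⟩
  · exact measureReal_mono fun ω hω => ⟨⟨hω.1.1, hω.2⟩, hω.1.2⟩

/-- A nonempty set of actions differs from `{S}` exactly when it contains the wrong action.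
Nonemptiness is inherited from an agent's accumulation points, hence holds only almost surely. -/
lemma IsCommonLimit.compl_eq_state_ae [Nonempty V] (hA : IsCommonLimit μ₀ μ₁ τ G A) :
    ({ω | A ω = {ω.1}}ᶜ : Set (World V Ω)) =ᵐ[law V μ₀ μ₁]
      (⋃ a, ({ω | a ∈ A ω} ∩ {ω | ω.1 = !a}) : Set (World V Ω)) := by
  obtain ⟨i⟩ := ‹Nonempty V›
  filter_upwards [hA.2] with ω hω
  have h := exists_mem_limitActions μ₀ μ₁ τ G i ω true
  rw [hω i] at h
  refine propext ?_
  change ¬ (A ω = {ω.1}) ↔ ω ∈ ⋃ a, _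
  simp only [Set.mem_iUnion, Set.mem_inter_iff, Set.mem_ofPred_eq, Bool.exists_bool,
    Set.ext_iff, Bool.forall_bool, Set.mem_singleton_iff]
  cases ω.1 <;> simp at h ⊢ <;> tauto

lemma IsCommonLimit.one_sub_law_real [Nonempty V] (hA : IsCommonLimit μ₀ μ₁ τ G A) :
    1 - (law V μ₀ μ₁).real {ω | A ω = {ω.1}} =
      (law V μ₀ μ₁).real ({ω | false ∈ A ω} ∩ {ω | ω.1 = true}) +
        (law V μ₀ μ₁).real ({ω | true ∈ A ω} ∩ {ω | ω.1 = false}) := by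
  rw [← probReal_compl_eq_one_sub hA.measurableSet_eq_state,
    measureReal_congr hA.compl_eq_state_ae, ← measureReal_union]
  · congr 1
    ext ω
    simp
  · refine Set.disjoint_left.2 fun ω h h' => ?_
    have h1 : ω.1 = true := h.2
    have h2 : ω.1 = false := h'.2
    simp [h1] at h2
  · exact (hA.measurableSet true).inter (measurableSet_state false)

/-- If some agent can tell the state of the world with a small error, then the common limit action
set is correct with a small error. -/
lemma IsCommonLimit.one_sub_law_real_le (hA : IsCommonLimit μ₀ μ₁ τ G A) (i : V)
    {D : Set (World V Ω)} (hD : MeasurableSet[limitInfo μ₀ μ₁ τ G i] D) :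
    1 - (law V μ₀ μ₁).real {ω | A ω = {ω.1}} ≤
      2 * ((law V μ₀ μ₁).real (D ∩ {ω | ω.1 = false}) +
        (law V μ₀ μ₁).real (Dᶜ ∩ {ω | ω.1 = true})) := by
  have : Nonempty V := ⟨i⟩
  rw [hA.one_sub_law_real]
  have h1 := hA.law_real_wrong_le i hD true
  have h2 := hA.law_real_wrong_le i hD.compl false
  rw [compl_compl] at h2
  have h3 (E F : Set (World V Ω)) : (law V μ₀ μ₁).real (E ∩ F) ≤ (law V μ₀ μ₁).real E :=
    measureReal_mono Set.inter_subset_left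
  simp only [Bool.not_true, Bool.not_false] at h1 h2
  -- Both actions may be accumulation points at once, so each error of the test can be counted once
  -- per action. This is the factor 2.
  have h4 := h3 (D ∩ {ω | ω.1 = false}) {ω | true ∈ A ω}
  have h5 := h3 (Dᶜ ∩ {ω | ω.1 = true}) {ω | true ∈ A ω}
  have h6 := h3 (D ∩ {ω | ω.1 = false}) {ω | false ∈ A ω}
  have h7 := h3 (Dᶜ ∩ {ω | ω.1 = true}) {ω | false ∈ A ω}
  linarith

lemma IsCommonLimit.law_real_inter_add_le (hA : IsCommonLimit μ₀ μ₁ τ G A)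
    (hu : law V μ₀ μ₁ ({ω | true ∈ A ω} ∩ {ω | false ∈ A ω}) = 0) {E : Set (World V Ω)} :
    (law V μ₀ μ₁).real (E ∩ {ω | true ∈ A ω}) + (law V μ₀ μ₁).real (E ∩ {ω | false ∈ A ω}) ≤
      (law V μ₀ μ₁).real E := by
  rw [← measureReal_inter_add_sdiff (hA.measurableSet true) (s := E)]
  refine add_le_add le_rfl ?_
  rw [← measureReal_inter_add_sdiff (hA.measurableSet true) (s := E ∩ _)]
  have h0 : (law V μ₀ μ₁).real (E ∩ {ω | false ∈ A ω} ∩ {ω | true ∈ A ω}) = 0 := by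
    rw [measureReal_def, measure_mono_null (Set.subset_inter Set.inter_subset_right
      (Set.inter_subset_left.trans Set.inter_subset_right)) hu, ENNReal.toReal_zero]
  rw [h0, zero_add]
  exact measureReal_mono fun ω hω => ⟨hω.1.1, hω.2⟩

/-- If the agents almost surely settle on one action, then the limit is at least as likely to be
correct as the action of any agent at any time. -/
lemma IsCommonLimit.law_real_action_le (hA : IsCommonLimit μ₀ μ₁ τ G A)
    (hu : law V μ₀ μ₁ ({ω | true ∈ A ω} ∩ {ω | false ∈ A ω}) = 0) (t : ℕ) (i : V) :
    (law V μ₀ μ₁).real {ω | action μ₀ μ₁ τ G t i ω = ω.1} ≤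
      (law V μ₀ μ₁).real {ω | A ω = {ω.1}} := by
  have : Nonempty V := ⟨i⟩
  set D : Set (World V Ω) := {ω | action μ₀ μ₁ τ G t i ω = true}
  have hD : MeasurableSet[limitInfo μ₀ μ₁ τ G i] D :=
    measurable_action_limitInfo μ₀ μ₁ τ G t (Set.mem_insert i _) (measurableSet_singleton true)
  have h1 := hA.law_real_wrong_le i hD true
  have h2 := hA.law_real_wrong_le i hD.compl false
  rw [compl_compl] at h2
  simp only [Bool.not_true, Bool.not_false] at h1 h2
  have hlim := hA.one_sub_law_real
  have h3 : 1 - (law V μ₀ μ₁).real {ω | action μ₀ μ₁ τ G t i ω = ω.1} =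
      (law V μ₀ μ₁).real (D ∩ {ω | ω.1 = false}) + (law V μ₀ μ₁).real (Dᶜ ∩ {ω | ω.1 = true}) :=
    one_sub_law_real_action μ₀ μ₁ τ G t i
  -- As at most one action survives almost surely, each error of the test is now counted once and no
  -- factor 2 appears.
  have h6 := hA.law_real_inter_add_le hu (E := D ∩ {ω | ω.1 = false})
  have h7 := hA.law_real_inter_add_le hu (E := Dᶜ ∩ {ω | ω.1 = true})
  linarith

end CommonLimit

/-! ### Actions at a given time depend on a finite neighbourhood -/

section Locality

/-- Conditional expectations given random variables are carried along measure preserving maps, and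
depend on the random variable only up to null sets. -/
lemma condExp_comp_ae_eq {X X' Z : Type*} [MeasurableSpace X] [MeasurableSpace X']
    [MeasurableSpace Z] {μ : Measure X} {μ' : Measure X'} [IsFiniteMeasure μ] [IsFiniteMeasure μ']
    {p : X → X'} (hp : MeasurePreserving p μ μ') {Y : X → Z} {Y' : X' → Z} (hY : Measurable Y)
    (hY' : Measurable Y') (hYY' : Y =ᵐ[μ] Y' ∘ p) {f : X' → ℝ} (hf : Integrable f μ') :
    μ'[f | MeasurableSpace.comap Y' inferInstance] ∘ p =ᵐ[μ]
      μ[f ∘ p | MeasurableSpace.comap Y inferInstance] := by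
  set g := μ'[f | MeasurableSpace.comap Y' inferInstance] with hg
  have hgi : Integrable g μ' := integrable_condExp
  have hgp : Integrable (g ∘ p) μ := hp.integrable_comp_of_integrable hgi
  refine ae_eq_condExp_of_forall_setIntegral_eq hY.comap_le (hp.integrable_comp_of_integrable hf)
    (fun s _ _ => hgp.integrableOn) ?_ ?_
  · rintro _ ⟨s, hs, rfl⟩ -
    have hae : (Y ⁻¹' s : Set X) =ᵐ[μ] p ⁻¹' (Y' ⁻¹' s) := by
      filter_upwards [hYY'] with x hx
      refine propext ?_
      change Y x ∈ s ↔ Y' (p x) ∈ s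
      rw [hx, Function.comp_apply]
    have hpre (h : X' → ℝ) (hh : Integrable h μ') :
        ∫ x in p ⁻¹' (Y' ⁻¹' s), (h ∘ p) x ∂μ = ∫ x in Y' ⁻¹' s, h x ∂μ' := by
      rw [← hp.map_eq, setIntegral_map (hY' hs) (by rw [hp.map_eq]; exact hh.aestronglyMeasurable)
        hp.aemeasurable]
      rfl
    rw [setIntegral_congr_set hae, setIntegral_congr_set hae, hpre g hgi, hpre f hf,
      setIntegral_condExp hY'.comap_le hf ⟨s, hs, rfl⟩]
  -- `g ∘ p` is a function of `Y' ∘ p`, which is only almost surely `Y`. Factoring `g` through `Y'`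
  -- (Doob–Dynkin) yields the version `φ ∘ Y`, measurable with respect to `Y`.
  · obtain ⟨φ, hφ, hφg⟩ := (stronglyMeasurable_condExp (μ := μ') (f := f)
      (m := MeasurableSpace.comap Y' inferInstance)).measurable.exists_eq_measurable_comp
    refine ⟨φ ∘ Y, (hφ.comp (comap_measurable Y)).stronglyMeasurable, ?_⟩
    filter_upwards [hYY'] with x hx
    rw [Function.comp_apply, Function.comp_apply, hx, hg, hφg]
    rfl

variable {V K : Type*} {Ω : Type*} [MeasurableSpace Ω]
variable (μ₀ μ₁ : Measure Ω) [IsProbabilityMeasure μ₀] [IsProbabilityMeasure μ₁]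

/-- Injectivity of `e` makes `pull e` measure preserving, and `hN` matches the closed
neighbourhoods, so both agents observe the same data almost surely. Posteriors, being conditional
expectations, can only be compared up to null sets. -/
lemma belief_comp_pull_ae_eq {G : SimpleGraph V} {H : SimpleGraph K} [H.LocallyFinite] {e : K → V}
    (he : e.Injective) {c : K} (hN : G.neighborSet (e c) = e '' H.neighborSet c)
    {past : V → World V Ω → List Bool} {past' : K → World K Ω → List Bool}
    (hm : ∀ j, Measurable (past j)) (hm' : ∀ j, Measurable (past' j))
    (hpast : ∀ j ∈ insert c (H.neighborSet c), past (e j) =ᵐ[law V μ₀ μ₁] past' j ∘ pull e) :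
    belief μ₀ μ₁ G past (e c) =ᵐ[law V μ₀ μ₁] belief μ₀ μ₁ H past' c ∘ pull e := by
  classical
  let J := ↥(insert c (H.neighborSet c))
  have : Finite J := ((Set.toFinite (H.neighborSet c)).insert c)
  let k : J → K := Subtype.val
  have hk : Set.range k = insert c (H.neighborSet c) := Subtype.range_val
  have hek : Set.range (e ∘ k) = insert (e c) (G.neighborSet (e c)) := by
    rw [Set.range_comp, hk, Set.image_insert_eq, hN]
  unfold belief
  rw [info_eq_comap past hek, info_eq_comap past' hk]
  have hobs : observation past (e c) (e ∘ k) =ᵐ[law V μ₀ μ₁] observation past' c k ∘ pull e := by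
    have h : ∀ᵐ ω ∂(law V μ₀ μ₁), ∀ j : J, past (e (k j)) ω = past' (k j) (pull e ω) :=
      ae_all_iff.2 fun j => hpast _ j.2
    filter_upwards [h] with ω hω
    exact Prod.ext rfl (funext hω)
  refine (condExp_comp_ae_eq (measurePreserving_pull μ₀ μ₁ he) (measurable_observation hm _ _)
    (measurable_observation hm' _ _) hobs
    ((integrable_const 1).indicator (measurableSet_state true))).symm

lemma bestAction_comp_pull_ae_eq (τ : TieRule Ω) {G : SimpleGraph V} {H : SimpleGraph K}
    [G.LocallyFinite] [H.LocallyFinite] {e : K → V}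
    (he : e.Injective) {c : K} (hN : G.neighborSet (e c) = e '' H.neighborSet c)
    {past : V → World V Ω → List Bool} {past' : K → World K Ω → List Bool}
    (hm : ∀ j, Measurable (past j)) (hm' : ∀ j, Measurable (past' j))
    (hpast : ∀ j ∈ insert c (H.neighborSet c), past (e j) =ᵐ[law V μ₀ μ₁] past' j ∘ pull e) :
    bestAction μ₀ μ₁ τ G past (e c) =ᵐ[law V μ₀ μ₁] bestAction μ₀ μ₁ τ H past' c ∘ pull e := by
  have hfin : G.neighborFinset (e c) = (H.neighborFinset c).map ⟨e, he⟩ := by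
    ext j
    simpa using Set.ext_iff.1 hN j
  have h : ∀ᵐ ω ∂(law V μ₀ μ₁), ∀ j : ↥(insert c (H.neighborSet c)),
      past (e j) ω = past' j (pull e ω) := by
    have : Finite ↥(insert c (H.neighborSet c)) := ((Set.toFinite (H.neighborSet c)).insert c)
    exact ae_all_iff.2 fun j => hpast _ j.2
  filter_upwards [h, belief_comp_pull_ae_eq μ₀ μ₁ he hN hm hm' hpast] with ω hω hb
  have hmul : ((G.neighborFinset (e c)).val.map fun j => past j ω) =
      (H.neighborFinset c).val.map fun j => past' j (pull e ω) := by
    rw [hfin, Finset.map_val, Multiset.map_map]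
    refine Multiset.map_congr rfl fun j hj => ?_
    exact hω ⟨j, Set.mem_insert_of_mem _ (by simpa using hj)⟩
  simp only [bestAction, Function.comp_apply] at hb ⊢
  rw [hb, hmul, hω ⟨c, Set.mem_insert _ _⟩]
  rfl

/-- All the vertices within distance `t` of the given one are in `K`. -/
def Deep {V' : Type*} (G' : SimpleGraph V') (K : Set V') : ℕ → V' → Prop
  | 0 => fun c => c ∈ K
  | t + 1 => fun c => c ∈ K ∧ ∀ c' ∈ G'.neighborSet c, Deep G' K t c'

lemma Deep.mem {V' : Type*} {G' : SimpleGraph V'} {K : Set V'} {t : ℕ} {c : V'}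
    (h : Deep G' K t c) : c ∈ K := by
  cases t with
  | zero => exact h
  | succ t => exact h.1

lemma Deep.of_succ {V' : Type*} {G' : SimpleGraph V'} {K : Set V'} {t : ℕ} {c : V'}
    (h : Deep G' K (t + 1) c) : Deep G' K t c := by
  induction t generalizing c with
  | zero => exact h.1
  | succ t ih => exact ⟨h.1, fun c' hc' => ih (h.2 c' hc')⟩

lemma Deep.mono {V' : Type*} {G' : SimpleGraph V'} {K K' : Set V'} (hK : K ⊆ K') {t : ℕ} {c : V'}
    (h : Deep G' K t c) : Deep G' K' t c := by
  induction t generalizing c with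
  | zero => exact hK h
  | succ t ih => exact ⟨hK h.1, fun c' hc' => ih (h.2 c' hc')⟩

lemma exists_finite_deep {V' : Type*} (G' : SimpleGraph V') [G'.LocallyFinite] (t : ℕ) (c : V') :
    ∃ K : Set V', K.Finite ∧ Deep G' K t c := by
  induction t generalizing c with
  | zero => exact ⟨{c}, Set.finite_singleton c, rfl⟩
  | succ t ih =>
    choose K hK hd using ih
    refine ⟨insert c (⋃ c' ∈ G'.neighborSet c, K c'), ?_, Set.mem_insert _ _, fun c' hc' => ?_⟩
    · exact ((Set.toFinite (G'.neighborSet c)).biUnion fun c' _ => hK c').insert c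
    · exact (hd c').mono ((Set.subset_biUnion_of_mem hc').trans (Set.subset_insert _ _))

/-- The actions of an agent up to time `t` are determined by its neighbourhood of radius `t`. -/
theorem history_ae_eq_of_deep (τ : TieRule Ω) {V' : Type*} {G : SimpleGraph V} [G.LocallyFinite]
    {G' : SimpleGraph V'} {K : Set V'} [(G'.induce K).LocallyFinite] {e : V' → V}
    (he : Set.InjOn e K) (hN : ∀ c ∈ K, G.neighborSet (e c) = e '' G'.neighborSet c) {t : ℕ}
    {c : V'} (hc : Deep G' K t c) :
    history μ₀ μ₁ τ G t (e c) =ᵐ[law V μ₀ μ₁]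
      history μ₀ μ₁ τ (G'.induce K) t ⟨c, hc.mem⟩ ∘ pull (fun k : K => e k) := by
  induction t generalizing c with
  | zero => exact Eventually.of_forall fun _ => rfl
  | succ t ih =>
    have hset : G.neighborSet (e c) =
        (fun k : K => e k) '' (G'.induce K).neighborSet ⟨c, hc.mem⟩ := by
      rw [hN c hc.mem]
      ext v
      constructor
      · rintro ⟨c', hc', rfl⟩
        exact ⟨⟨c', (hc.2 c' hc').mem⟩, hc', rfl⟩
      · rintro ⟨c', hc', rfl⟩
        exact ⟨c', hc', rfl⟩
    have hbest := bestAction_comp_pull_ae_eq μ₀ μ₁ τ (e := fun k : K => e k)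
      (fun x y hxy => Subtype.ext (he x.2 y.2 hxy)) (c := ⟨c, hc.mem⟩) hset
      (measurable_history μ₀ μ₁ τ G t) (measurable_history μ₀ μ₁ τ (G'.induce K) t) (by
        rintro j (rfl | hj)
        · exact ih hc.of_succ
        · exact ih (hc.2 j hj))
    filter_upwards [ih hc.of_succ, hbest] with ω h1 h2
    change _ ++ [_] = _ ++ [_]
    rw [h1, h2]
    rfl

/-- The action at time `t` is the last entry of the history of length `t + 1`, hence depth `t + 1`.
Even at time 0 the neighbours have to lie in `K`, since the tie rule sees their number. -/
theorem action_ae_eq_of_deep (τ : TieRule Ω) {V' : Type*} {G : SimpleGraph V} [G.LocallyFinite]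
    {G' : SimpleGraph V'} {K : Set V'} [(G'.induce K).LocallyFinite] {e : V' → V}
    (he : Set.InjOn e K) (hN : ∀ c ∈ K, G.neighborSet (e c) = e '' G'.neighborSet c) {t : ℕ}
    {c : V'} (hc : Deep G' K (t + 1) c) :
    action μ₀ μ₁ τ G t (e c) =ᵐ[law V μ₀ μ₁]
      action μ₀ μ₁ τ (G'.induce K) t ⟨c, hc.mem⟩ ∘ pull (fun k : K => e k) := by
  filter_upwards [history_ae_eq_of_deep μ₀ μ₁ τ he hN hc] with ω hω
  rw [Function.comp_apply] at hω ⊢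
  rw [action_eq_getLast, action_eq_getLast, hω]

end Locality

/-! ### Local limits of bounded-degree graphs via ultraproducts -/

section GraphLimit

/-- Every vertex is at finite distance from a root, and the vertices reached in `n` steps form a
countable set. This makes a component of the ultraproduct eligible for `GuaranteesAgreement`. -/
lemma countable_of_connected {V : Type*} {G : SimpleGraph V} (hG : G.Connected)
    (hfin : ∀ v, (G.neighborSet v).Finite) : Countable V := by
  obtain ⟨r⟩ := hG.nonempty
  let S : ℕ → Set V := fun n => Nat.rec {r} (fun _ T => ⋃ v ∈ T, G.neighborSet v) n
  have hS : ∀ n, (S n).Countable := fun n => by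
    induction n with
    | zero => exact Set.countable_singleton r
    | succ n ih => exact ih.biUnion fun v _ => (hfin v).countable
  have hU : (⋃ n, S n) = Set.univ := by
    refine Set.eq_univ_of_forall fun v => ?_
    induction (SimpleGraph.reachable_iff_reflTransGen r v).1 (hG.preconnected r v) with
    | refl => exact Set.mem_iUnion.2 ⟨0, rfl⟩
    | tail _ h ih =>
      obtain ⟨n, hn⟩ := Set.mem_iUnion.1 ih
      exact Set.mem_iUnion.2 ⟨n + 1, Set.mem_biUnion hn h⟩
  rw [← Set.countable_univ_iff, ← hU]
  exact Set.countable_iUnion hS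

/-- A set of vertices that is closed under adjacency is everything. -/
lemma forall_of_connected {V : Type*} {G : SimpleGraph V} (hG : G.Connected) {P : V → Prop} {r : V}
    (hr : P r) (hP : ∀ v w, G.Adj v w → P v → P w) (v : V) : P v := by
  induction (SimpleGraph.reachable_iff_reflTransGen r v).1 (hG.preconnected r v) with
  | refl => exact hr
  | tail _ h ih => exact hP _ _ h ih

/-- Along `l`, the maps `e n` from `G'` to `G n` are isomorphisms on every finite part of `G'`. -/
structure IsLocalLimit (l : Filter ℕ) {V : ℕ → Type*} (G : ∀ n, SimpleGraph (V n)) {V' : Type*}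
    (G' : SimpleGraph V') (e : ∀ n, V' → V n) : Prop where
  ne : ∀ x y, x ≠ y → ∀ᶠ n in l, e n x ≠ e n y
  neighborSet : ∀ x, ∀ᶠ n in l, (G n).neighborSet (e n x) = e n '' G'.neighborSet x

lemma IsLocalLimit.eventually_on {l : Filter ℕ} {V : ℕ → Type*} {G : ∀ n, SimpleGraph (V n)}
    {V' : Type*} {G' : SimpleGraph V'} {e : ∀ n, V' → V n} (h : IsLocalLimit l G G' e)
    {K : Set V'} (hK : K.Finite) :
    ∀ᶠ n in l, Set.InjOn (e n) K ∧
      ∀ c ∈ K, (G n).neighborSet (e n c) = e n '' G'.neighborSet c := by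
  have h1 : ∀ᶠ n in l, ∀ x ∈ K, ∀ y ∈ K, x ≠ y → e n x ≠ e n y :=
    hK.eventually_all.2 fun x _ => hK.eventually_all.2 fun y _ => by
      by_cases hxy : x = y
      · simp [hxy]
      · simpa [hxy] using h.ne x y hxy
  filter_upwards [h1, hK.eventually_all.2 fun x _ => h.neighborSet x] with n hn hn'
  exact ⟨fun x hx y hy hxy => by_contra fun hne => hn x hx y hy hne hxy, hn'⟩

/-- If one vertex escapes to infinity, then all of them do. -/
lemma IsLocalLimit.eventually_ne {l : Filter ℕ} {V : Type*} {G : SimpleGraph V}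
    [G.LocallyFinite] {V' : Type*} {G' : SimpleGraph V'} (hG' : G'.Connected) {e : ℕ → V' → V}
    (h : IsLocalLimit l (fun _ => G) G' e) {r : V'} (hr : ∀ x, ∀ᶠ n in l, e n r ≠ x) (v : V')
    (x : V) : ∀ᶠ n in l, e n v ≠ x := by
  refine forall_of_connected hG' (P := fun v => ∀ x, ∀ᶠ n in l, e n v ≠ x) hr ?_ v x
  intro v w hvw hv x
  have hx : ∀ᶠ n in l, ∀ y ∈ G.neighborSet x, e n v ≠ y :=
    (Set.toFinite (G.neighborSet x)).eventually_all.2 fun y _ => hv y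
  filter_upwards [hx, h.neighborSet v] with n hn hn' hw
  have : e n w ∈ G.neighborSet (e n v) := by
    rw [hn']; exact Set.mem_image_of_mem _ hvw
  rw [hw] at this
  exact hn _ (G.adj_symm this) rfl

/-- The vertices of the ultraproduct of a sequence of graphs. -/
def ultraSetoid (U : Ultrafilter ℕ) (V : ℕ → Type*) : Setoid (∀ n, V n) where
  r x y := ∀ᶠ n in U, x n = y n
  iseqv := ⟨fun _ => Eventually.of_forall fun _ => rfl, fun h => h.mono fun _ h => h.symm,
    fun h h' => by filter_upwards [h, h'] with n h1 h2 using h1.trans h2⟩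

/-- The ultraproduct of a sequence of graphs. -/
noncomputable def ultraGraph (U : Ultrafilter ℕ) {V : ℕ → Type*} (G : ∀ n, SimpleGraph (V n)) :
    SimpleGraph (Quotient (ultraSetoid U V)) where
  Adj x y := ∀ᶠ n in U, (G n).Adj (x.out n) (y.out n)
  symm := ⟨fun _ _ h => h.mono fun _ h => h.symm⟩
  loopless := ⟨fun x h => by
    obtain ⟨n, hn⟩ := h.exists
    exact (G n).loopless.irrefl _ hn⟩

section Ultra

variable (U : Ultrafilter ℕ) {V : ℕ → Type*}

lemma ultra_mk_out (x : ∀ n, V n) :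
    ∀ᶠ n in U, (Quotient.mk (ultraSetoid U V) x).out n = x n :=
  Quotient.mk_out (s := ultraSetoid U V) x

lemma ultra_ne {x y : Quotient (ultraSetoid U V)} (h : x ≠ y) : ∀ᶠ n in U, x.out n ≠ y.out n := by
  rw [Ultrafilter.eventually_not]
  intro h'
  apply h
  rw [← x.out_eq, ← y.out_eq]
  exact Quotient.sound (s := ultraSetoid U V) h'

variable (G : ∀ n, SimpleGraph (V n))

/-- A set of `d + 1` neighbours involves finitely many adjacencies and inequalities, which would
hold simultaneously in some `G n`. -/
lemma encard_neighborSet_ultraGraph_le {d : ℕ} (hd : ∀ n v, ((G n).neighborSet v).encard ≤ d)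
    (x : Quotient (ultraSetoid U V)) : ((ultraGraph U G).neighborSet x).encard ≤ d := by
  by_contra! hlt
  obtain ⟨T, hT, hTc⟩ := Set.exists_subset_encard_eq (Order.add_one_le_of_lt hlt)
  have hTfin : T.Finite := Set.finite_of_encard_eq_coe (k := d + 1) (by simpa using hTc)
  have h1 : ∀ᶠ n in U, ∀ y ∈ T, (G n).Adj (x.out n) (y.out n) :=
    hTfin.eventually_all.2 fun y hy => hT hy
  have h2 : ∀ᶠ n in U, ∀ y ∈ T, ∀ z ∈ T, y ≠ z → y.out n ≠ z.out n :=
    hTfin.eventually_all.2 fun y _ => hTfin.eventually_all.2 fun z _ => by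
      by_cases hyz : y = z
      · simp [hyz]
      · simpa [hyz] using ultra_ne U hyz
  obtain ⟨n, hn1, hn2⟩ := (h1.and h2).exists
  have hinj : Set.InjOn (fun y : Quotient (ultraSetoid U V) => y.out n) T :=
    fun y hy z hz hyz => by_contra fun hne => hn2 y hy z hz hne hyz
  have hsub : (fun y : Quotient (ultraSetoid U V) => y.out n) '' T ⊆
      (G n).neighborSet (x.out n) := by
    rintro _ ⟨y, hy, rfl⟩
    exact hn1 y hy
  have := (Set.encard_le_encard hsub).trans (hd n _)
  rw [hinj.encard_image, hTc] at this
  exact absurd this (by exact_mod_cast (by omega : ¬ d + 1 ≤ d))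

/-- If the representatives missed a neighbour for `U`-almost all `n`, the missed neighbours would
themselves define a vertex of the ultraproduct: a neighbour of `x` different from all neighbours of
`x`. -/
lemma neighborSet_ultraGraph {x : Quotient (ultraSetoid U V)}
    (hfin : ((ultraGraph U G).neighborSet x).Finite) :
    ∀ᶠ n in U, (G n).neighborSet (x.out n) =
      (fun y : Quotient (ultraSetoid U V) => y.out n) '' (ultraGraph U G).neighborSet x := by
  have h1 : ∀ᶠ n in U, ∀ y ∈ (ultraGraph U G).neighborSet x, (G n).Adj (x.out n) (y.out n) :=
    hfin.eventually_all.2 fun y hy => hy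
  have h2 : ∀ᶠ n in U, ∀ v ∈ (G n).neighborSet (x.out n),
      ∃ y ∈ (ultraGraph U G).neighborSet x, y.out n = v := by
    by_contra hcon
    rw [← Ultrafilter.eventually_not] at hcon
    have hcon' : ∀ᶠ n in U, ∃ v, (G n).Adj (x.out n) v ∧
        ∀ y ∈ (ultraGraph U G).neighborSet x, y.out n ≠ v := by
      filter_upwards [hcon] with n hn
      push Not at hn
      exact hn
    classical
    let z : ∀ n, V n := fun n => if h : ∃ v, (G n).Adj (x.out n) v ∧
        ∀ y ∈ (ultraGraph U G).neighborSet x, y.out n ≠ v then h.choose else x.out n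
    have hz : ∀ᶠ n in U, (G n).Adj (x.out n) (z n) ∧
        ∀ y ∈ (ultraGraph U G).neighborSet x, y.out n ≠ z n := by
      filter_upwards [hcon'] with n hn
      simp only [z, dif_pos hn]
      exact hn.choose_spec
    have hout := ultra_mk_out U z
    have hadj : Quotient.mk (ultraSetoid U V) z ∈ (ultraGraph U G).neighborSet x := by
      change ∀ᶠ n in U, (G n).Adj (x.out n) ((Quotient.mk (ultraSetoid U V) z).out n)
      filter_upwards [hz, hout] with n hn hn'
      rw [hn']
      exact hn.1
    obtain ⟨n, hn, hn'⟩ := (hz.and hout).exists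
    exact hn.2 _ hadj hn'
  filter_upwards [h1, h2] with n hn1 hn2
  ext v
  exact ⟨fun hv => hn2 v hv, by rintro ⟨y, hy, rfl⟩; exact hn1 y hy⟩

end Ultra

/-- Connected graphs of bounded degree and growing size have an infinite local limit. -/
theorem exists_isLocalLimit (U : Ultrafilter ℕ) {V : ℕ → Type} (G : ∀ n, SimpleGraph (V n))
    (hconn : ∀ n, (G n).Connected) {d : ℕ} (hd : ∀ n v, ((G n).neighborSet v).encard ≤ d)
    (hcard : ∀ m : ℕ, ∀ᶠ n in U, (m : ℕ∞) < ENat.card (V n)) (root : ∀ n, V n) :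
    ∃ (V' : Type) (G' : SimpleGraph V') (e : ∀ n, V' → V n), Countable V' ∧ Infinite V' ∧
      G'.Connected ∧ (∀ v, (G'.neighborSet v).encard ≤ d) ∧ IsLocalLimit U G G' e ∧
      ∃ r, ∀ᶠ n in U, e n r = root n := by
  -- The ultraproduct itself need be neither connected nor countable; the component of the root is
  -- both.
  let C := (ultraGraph U G).connectedComponentMk (Quotient.mk (ultraSetoid U V) root)
  let e : ∀ n, C → V n := fun n x => x.1.out n
  have himg (x : C) : Subtype.val '' C.toSimpleGraph.neighborSet x =
      (ultraGraph U G).neighborSet x.1 := by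
    ext y
    constructor
    · rintro ⟨y, hy, rfl⟩
      exact hy
    · intro hy
      exact ⟨⟨y, C.mem_supp_of_adj_mem_supp x.2 hy⟩, hy, rfl⟩
  have hdeg (x : C) : (C.toSimpleGraph.neighborSet x).encard ≤ d := by
    rw [← Subtype.val_injective.encard_image, himg]
    exact encard_neighborSet_ultraGraph_le U G hd x.1
  have hlim : IsLocalLimit U G C.toSimpleGraph e := by
    refine ⟨fun x y hxy => ultra_ne U (Subtype.coe_ne_coe.2 hxy), fun x => ?_⟩
    filter_upwards [neighborSet_ultraGraph U G (x := x.1) (Set.finite_of_encard_le_coe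
      (encard_neighborSet_ultraGraph_le U G hd x.1))] with n hn
    rw [hn, ← himg, Set.image_image]
  have hC := C.connected_toSimpleGraph
  refine ⟨C, C.toSimpleGraph, e, countable_of_connected hC fun v =>
    Set.finite_of_encard_le_coe (hdeg v), ?_, hC, hdeg, hlim,
    ⟨⟨Quotient.mk (ultraSetoid U V) root, rfl⟩, ultra_mk_out U root⟩⟩
  rw [← not_finite_iff_infinite]
  intro hfin
  -- Were `C` finite, `e n` would match neighbourhoods on all of `C` at once. Its image would then
  -- be closed under adjacency, hence all of `V n`, which is too large.
  have h1 := (hlim.eventually_on (Set.finite_univ (α := C))).and (hcard (Nat.card C))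
  obtain ⟨n, ⟨-, hn⟩, hn'⟩ := h1.exists
  have hsurj : Function.Surjective (e n) := by
    intro v
    obtain ⟨x⟩ := hC.nonempty
    refine forall_of_connected (hconn n) (P := fun v => ∃ y, e n y = v) (r := e n x) ⟨x, rfl⟩ ?_ v
    rintro _ w hw ⟨y, rfl⟩
    have : w ∈ (G n).neighborSet (e n y) := hw
    rw [hn y (Set.mem_univ y)] at this
    exact ⟨_, this.choose_spec.2⟩
  have := Finite.of_surjective _ hsurj
  rw [ENat.card_eq_coe_natCard] at hn'
  exact absurd (Nat.card_le_card_of_surjective _ hsurj) (by exact_mod_cast not_le.2 hn')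

end GraphLimit

/-! ### Asymptotic independence at infinity -/

section Mixing

/-- An event of an infinite product of probability spaces is asymptotically independent of what
happens in finitely many coordinates that escape to infinity. -/
theorem tendsto_infinitePi_real_inter {ι V K Ω : Type*} [MeasurableSpace Ω] {μ : Measure Ω}
    [IsProbabilityMeasure μ] [Finite K] {l : Filter ι} {e : ι → K → V}
    (hinj : ∀ᶠ n in l, (e n).Injective) (hesc : ∀ k x, ∀ᶠ n in l, e n k ≠ x)
    {D : Set (K → Ω)} (hD : MeasurableSet D) {E : Set (V → Ω)} (hE : MeasurableSet E) :
    Tendsto (fun n => (Measure.infinitePi fun _ : V => μ).real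
        (E ∩ (fun w k => w (e n k)) ⁻¹' D)) l
      (𝓝 ((Measure.infinitePi fun _ : V => μ).real E *
        (Measure.infinitePi fun _ : K => μ).real D)) := by
  classical
  set ν := Measure.infinitePi fun _ : V => μ with hν
  set D' : ι → Set (V → Ω) := fun n => (fun w k => w (e n k)) ⁻¹' D with hD'
  have hD'm (n : ι) : MeasurableSet (D' n) := by
    have : Measurable (fun (w : V → Ω) k => w (e n k)) := by fun_prop
    exact this hD
  have hD'r : ∀ᶠ n in l, ν.real (D' n) = (Measure.infinitePi fun _ : K => μ).real D := by
    filter_upwards [hinj] with n hn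
    have := Measure.map_infinitePi_infinitePi_of_inj (P := fun _ : V => μ) hn
    rw [← this, map_measureReal_apply (by fun_prop) hD]
  induction E, hE using MeasurableSpace.induction_on_inter
    (generateFrom_measurableCylinders (α := fun _ : V => Ω)).symm
    (isPiSystem_measurableCylinders (α := fun _ : V => Ω)) with
  | empty => simpa using tendsto_const_nhds
  | basic E hE =>
    -- A cylinder depends on finitely many coordinates `F`, which the escaping coordinates
    -- eventually avoid; from then on independence is exact.
    obtain ⟨F, S, hS, rfl⟩ := (mem_measurableCylinders _).1 hE
    have hdisj : ∀ᶠ n in l, ∀ k, ∀ x ∈ F, e n k ≠ x :=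
      eventually_all.2 fun k => F.eventually_all.2 fun x _ => hesc k x
    have := Fintype.ofFinite K
    refine tendsto_const_nhds.congr' ?_
    filter_upwards [hdisj, hD'r] with n hn hr
    rw [← hr]
    let T := Finset.univ.image (e n)
    have hFT : Disjoint F T := Finset.disjoint_left.2 fun x hx hxT => by
      obtain ⟨k, -, rfl⟩ := Finset.mem_image.1 hxT
      exact hn k _ hx rfl
    have hind := (iIndepFun_infinitePi (P := fun _ : V => μ) (X := fun _ x => x)
      fun _ => measurable_id).indepFun_finset F T hFT fun i => measurable_pi_apply i
    have hmem (k : K) : e n k ∈ T := Finset.mem_image_of_mem _ (Finset.mem_univ k)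
    have hS' : MeasurableSet {y : T → Ω | (fun k => y ⟨e n k, hmem k⟩) ∈ D} := by
      have : Measurable fun (y : T → Ω) k => y ⟨e n k, hmem k⟩ := by fun_prop
      exact this hD
    have := hind.measure_inter_preimage_eq_mul _ _ hS hS'
    rw [measureReal_def, measureReal_def, measureReal_def, ← ENNReal.toReal_mul]
    exact congrArg ENNReal.toReal this.symm
  | compl E hE ih =>
    have h1 : ∀ᶠ n in l, (Measure.infinitePi fun _ : K => μ).real D - ν.real (E ∩ D' n) =
        ν.real (Eᶜ ∩ D' n) := by
      filter_upwards [hD'r] with n hn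
      rw [← hn, ← measureReal_inter_add_sdiff hE (s := D' n), Set.inter_comm E, Set.inter_comm Eᶜ,
        add_sub_cancel_left]
      rfl
    rw [probReal_compl_eq_one_sub hE, sub_mul, one_mul]
    exact (tendsto_const_nhds.sub ih).congr' h1
  | iUnion E hdisj hE ih =>
    have h1 (n : ι) : ν.real ((⋃ i, E i) ∩ D' n) = ∑' i, ν.real (E i ∩ D' n) := by
      rw [Set.iUnion_inter, measureReal_def, measure_iUnion
        (fun i j hij => (hdisj hij).mono Set.inter_subset_left Set.inter_subset_left)
        fun i => (hE i).inter (hD'm n)]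
      exact ENNReal.tsum_toReal_eq fun i => measure_ne_top _ _
    have hsum : Summable fun i => ν.real (E i) := by
      refine ENNReal.summable_toReal ?_
      rw [← measure_iUnion hdisj hE]
      exact measure_ne_top _ _
    have h2 : ν.real (⋃ i, E i) = ∑' i, ν.real (E i) := by
      rw [measureReal_def, measure_iUnion hdisj hE]
      exact ENNReal.tsum_toReal_eq fun i => measure_ne_top _ _
    rw [funext h1, h2, ← tsum_mul_right]
    -- Uniformly in `n`, the terms are dominated by the summable masses of the `E i`.
    refine tendsto_tsum_of_dominated_convergence hsum ih (Eventually.of_forall fun n i => ?_)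
    rw [Real.norm_of_nonneg measureReal_nonneg]
    exact measureReal_mono Set.inter_subset_left

variable {V K : Type*} {Ω : Type*} [MeasurableSpace Ω]
variable (μ₀ μ₁ : Measure Ω) [IsProbabilityMeasure μ₀] [IsProbabilityMeasure μ₁]

/-- Mixing conditionally on the state. The factor 2 is the inverse of the prior 1/2, which enters
both factors on the right but only once on the left. -/
theorem tendsto_law_real_inter_pull {ι : Type*} [Finite K] {l : Filter ι} {e : ι → K → V}
    (hinj : ∀ᶠ n in l, (e n).Injective) (hesc : ∀ k x, ∀ᶠ n in l, e n k ≠ x)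
    {D : Set (World K Ω)} (hD : MeasurableSet D) {E : Set (World V Ω)} (hE : MeasurableSet E)
    (s : Bool) :
    Tendsto (fun n => (law V μ₀ μ₁).real (E ∩ pull (e n) ⁻¹' D ∩ {ω | ω.1 = s})) l
      (𝓝 (2 * (law V μ₀ μ₁).real (E ∩ {ω | ω.1 = s}) *
        (law K μ₀ μ₁).real (D ∩ {ω | ω.1 = s}))) := by
  have h := (tendsto_infinitePi_real_inter (μ := signalLaw μ₀ μ₁ s) hinj hesc
    (measurable_prodMk_left hD : MeasurableSet (Prod.mk s ⁻¹' D))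
    (measurable_prodMk_left hE : MeasurableSet (Prod.mk s ⁻¹' E))).const_mul (1 / 2)
  rw [law_real_inter_state μ₀ μ₁ V hE, law_real_inter_state μ₀ μ₁ K hD]
  convert h using 1
  · ext n
    rw [law_real_inter_state μ₀ μ₁ V (hE.inter (measurable_pull (e n) hD))]
    rfl
  · congr 1
    simp only [signalsLaw]
    ring

lemma law_real_signal_mem (i : V) {B : Set Ω} (hB : MeasurableSet B) (s : Bool) :
    (law V μ₀ μ₁).real ({ω | ω.2 i ∈ B} ∩ {ω | ω.1 = s}) = 1 / 2 * (signalLaw μ₀ μ₁ s).real B := by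
  have h : MeasurableSet {ω : World V Ω | ω.2 i ∈ B} := by
    have : Measurable fun ω : World V Ω => ω.2 i := by fun_prop
    exact this hB
  rw [law_real_inter_state μ₀ μ₁ V h]
  congr 1
  have := (measurePreserving_eval_infinitePi (fun _ : V => signalLaw μ₀ μ₁ s) i).measureReal_preimage
    hB.nullMeasurableSet
  exact this

lemma tendsto_law_real_inter_signal {ι : Type*} {l : Filter ι} {v : ι → V}
    (hesc : ∀ x, ∀ᶠ n in l, v n ≠ x) {B : Set Ω} (hB : MeasurableSet B) {E : Set (World V Ω)}
    (hE : MeasurableSet E) (s : Bool) :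
    Tendsto (fun n => (law V μ₀ μ₁).real (E ∩ {ω | ω.2 (v n) ∈ B} ∩ {ω | ω.1 = s})) l
      (𝓝 ((law V μ₀ μ₁).real (E ∩ {ω | ω.1 = s}) * (signalLaw μ₀ μ₁ s).real B)) := by
  have hD : MeasurableSet {ω : World Unit Ω | ω.2 () ∈ B} := by
    have : Measurable fun ω : World Unit Ω => ω.2 () := by fun_prop
    exact this hB
  have h := tendsto_law_real_inter_pull μ₀ μ₁ (K := Unit) (e := fun n _ => v n)
    (Eventually.of_forall fun n => Function.injective_of_subsingleton _) (fun _ x => hesc x)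
    hD hE s
  have e (x y : ℝ) : 2 * x * (1 / 2 * y) = x * y := by ring
  rw [law_real_signal_mem μ₀ μ₁ () hB, e] at h
  exact h

lemma exists_seq_escaping (V : Type*) [Infinite V] :
    ∃ v : ℕ → V, ∀ x, ∀ᶠ n in atTop, v n ≠ x := by
  refine ⟨Infinite.natEmbedding V, fun x => ?_⟩
  have h := (Infinite.natEmbedding V).injective.tendsto_cofinite
  rw [Nat.cofinite_eq_atTop] at h
  exact h.eventually (Set.finite_singleton x).compl_mem_cofinite

end Mixing

/-! ### Settling on one action in infinite graphs -/

section Infinite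

variable {V : Type*} {Ω : Type*} [MeasurableSpace Ω]
variable {μ₀ μ₁ : Measure Ω} [IsProbabilityMeasure μ₀] [IsProbabilityMeasure μ₁]
variable {τ : TieRule Ω} {G : SimpleGraph V} [G.LocallyFinite] {A : World V Ω → Set Bool}

lemma exists_measureReal_lt {μ ν : Measure Ω} [IsProbabilityMeasure μ] [IsProbabilityMeasure ν]
    (hne : μ ≠ ν) : ∃ B, MeasurableSet B ∧ μ.real B < ν.real B := by
  by_contra! h
  refine hne (Measure.ext fun B hB => ?_)
  have h1 := h B hB
  have h2 := h Bᶜ hB.compl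
  rw [probReal_compl_eq_one_sub hB, probReal_compl_eq_one_sub hB] at h2
  rw [← measureReal_eq_measureReal_iff]
  linarith

lemma measurableSet_signal_limitInfo (τ : TieRule Ω) (G : SimpleGraph V) [G.LocallyFinite] (i : V)
    {B : Set Ω} (hB : MeasurableSet B) :
    MeasurableSet[limitInfo μ₀ μ₁ τ G i] {ω : World V Ω | ω.2 i ∈ B} :=
  measurable_signal_limitInfo μ₀ μ₁ τ G i hB

/-- On an infinite graph, the private signals are asymptotically of no help in addition to the
common limit. -/
lemma IsCommonLimit.law_real_mul_signalLaw_le [Infinite V] (hA : IsCommonLimit μ₀ μ₁ τ G A)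
    (a : Bool) {B : Set Ω} (hB : MeasurableSet B) :
    (law V μ₀ μ₁).real ({ω | a ∈ A ω} ∩ {ω | ω.1 = !a}) * (signalLaw μ₀ μ₁ (!a)).real B ≤
      (law V μ₀ μ₁).real ({ω | a ∈ A ω} ∩ {ω | ω.1 = a}) * (signalLaw μ₀ μ₁ a).real B := by
  obtain ⟨v, hv⟩ := exists_seq_escaping V
  refine le_of_tendsto_of_tendsto'
    (tendsto_law_real_inter_signal μ₀ μ₁ hv hB (hA.measurableSet a) (!a))
    (tendsto_law_real_inter_signal μ₀ μ₁ hv hB (hA.measurableSet a) a) fun n => ?_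
  rw [Set.inter_comm {ω : World V Ω | a ∈ A ω}]
  exact hA.law_real_le (v n) (measurableSet_signal_limitInfo τ G (v n) hB) a

/-- On an infinite graph, the agents almost surely settle on one action. -/
theorem IsCommonLimit.law_undecided [Infinite V] (hA : IsCommonLimit μ₀ μ₁ τ G A) (hne : μ₀ ≠ μ₁) :
    law V μ₀ μ₁ ({ω | true ∈ A ω} ∩ {ω | false ∈ A ω}) = 0 := by
  obtain ⟨v, hv⟩ := exists_seq_escaping V
  set u : Set (World V Ω) := {ω | true ∈ A ω} ∩ {ω | false ∈ A ω} with hu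
  have hum : MeasurableSet u := (hA.measurableSet true).inter (hA.measurableSet false)
  have hle (a : Bool) (i : V) {D : Set (World V Ω)} (hD : MeasurableSet[limitInfo μ₀ μ₁ τ G i] D) :
      (law V μ₀ μ₁).real (u ∩ D ∩ {ω | ω.1 = !a}) ≤
        (law V μ₀ μ₁).real (u ∩ D ∩ {ω | ω.1 = a}) := by
    -- Being undecided makes both actions optimal, so either state is as likely as the other on `u ∩
    -- D`. The other action enters through `limitActions` of `i`, since `A` is measurable for the
    -- agent's information only up to null sets.
    have h := hA.law_real_le i
      (hD.inter (measurableSet_mem_limitActions μ₀ μ₁ τ G i (!a))) a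
    have heq (s : Bool) : (law V μ₀ μ₁).real (u ∩ D ∩ {ω | ω.1 = s}) = (law V μ₀ μ₁).real
        (D ∩ {ω | (!a) ∈ limitActions μ₀ μ₁ τ G i ω} ∩ {ω | a ∈ A ω} ∩ {ω | ω.1 = s}) := by
      refine measureReal_congr ?_
      filter_upwards [hA.2] with ω hω
      refine propext ?_
      change ((true ∈ A ω ∧ false ∈ A ω) ∧ ω ∈ D) ∧ ω.1 = s ↔
        ((ω ∈ D ∧ (!a) ∈ limitActions μ₀ μ₁ τ G i ω) ∧ a ∈ A ω) ∧ ω.1 = s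
      rw [hω i]
      cases a <;> simp only [Bool.not_true, Bool.not_false] <;> tauto
    rw [heq, heq]
    exact h
  have hB {B : Set Ω} (hB : MeasurableSet B) :
      (law V μ₀ μ₁).real (u ∩ {ω | ω.1 = false}) * μ₀.real B =
      (law V μ₀ μ₁).real (u ∩ {ω | ω.1 = true}) * μ₁.real B := by
    have ht (s : Bool) := tendsto_law_real_inter_signal μ₀ μ₁ hv hB hum s
    have hm (n : ℕ) := measurableSet_signal_limitInfo (μ₀ := μ₀) (μ₁ := μ₁) τ G (v n) hB
    exact le_antisymm (le_of_tendsto_of_tendsto' (ht false) (ht true) fun n => hle true _ (hm n))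
      (le_of_tendsto_of_tendsto' (ht true) (ht false) fun n => hle false _ (hm n))
  -- The whole space shows that `u` has equal mass in both states; a set `B` separating `μ₀` from
  -- `μ₁` then forces this mass to vanish.
  have h1 := hB .univ
  obtain ⟨B, hBm, hlt⟩ := exists_measureReal_lt hne
  have h2 := hB hBm
  simp only [probReal_univ, mul_one] at h1
  rw [h1] at h2
  have h3 : (law V μ₀ μ₁).real (u ∩ {ω | ω.1 = true}) = 0 := by
    by_contra h
    exact hlt.ne (mul_left_cancel₀ h h2)
  rw [← measureReal_eq_zero_iff, law_real_eq_add μ₀ μ₁ V u true, Bool.not_true, h1, h3, add_zero]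

/-- If the agents almost surely settle on one action, then the events that an action is taken
converge to the event that it is the limit. -/
lemma IsCommonLimit.tendsto_law_real_action (hA : IsCommonLimit μ₀ μ₁ τ G A)
    (hu : law V μ₀ μ₁ ({ω | true ∈ A ω} ∩ {ω | false ∈ A ω}) = 0) (i : V) (a : Bool)
    {E : Set (World V Ω)} (hE : MeasurableSet E) :
    Tendsto (fun t => (law V μ₀ μ₁).real ({ω | action μ₀ μ₁ τ G t i ω = a} ∩ E)) atTop
      (𝓝 ((law V μ₀ μ₁).real ({ω | a ∈ A ω} ∩ E))) := by
  refine (ENNReal.tendsto_toReal (measure_ne_top _ _)).comp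
    (tendsto_measure_of_ae_tendsto_indicator_of_isFiniteMeasure atTop
      ((hA.measurableSet a).inter hE)
      (fun t => (measurable_action μ₀ μ₁ τ G t i (measurableSet_singleton a)).inter hE) ?_)
  filter_upwards [hA.2, measure_eq_zero_iff_ae_notMem.1 hu] with ω hω hωu
  have hev : ∀ᶠ t in atTop, (action μ₀ μ₁ τ G t i ω = a ↔ a ∈ A ω) := by
    rw [← hω i]
    by_cases ha : a ∈ limitActions μ₀ μ₁ τ G i ω
    · have hna : (!a) ∉ limitActions μ₀ μ₁ τ G i ω := fun hna => hωu <| by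
        rw [hω i] at ha hna
        cases a
        · exact ⟨hna, ha⟩
        · exact ⟨ha, hna⟩
      rw [mem_limitActions, not_frequently] at hna
      filter_upwards [hna] with t ht
      simpa [ha] using ht
    · have hna := ha
      rw [mem_limitActions, not_frequently] at hna
      filter_upwards [hna] with t ht
      simpa [ha] using ht
  filter_upwards [hev] with t ht
  exact and_congr_left fun _ => ht

lemma IsCommonLimit.law_real_add_eq_half [Nonempty V] (hA : IsCommonLimit μ₀ μ₁ τ G A)
    (hu : law V μ₀ μ₁ ({ω | true ∈ A ω} ∩ {ω | false ∈ A ω}) = 0) (s : Bool) :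
    (law V μ₀ μ₁).real ({ω | true ∈ A ω} ∩ {ω | ω.1 = s}) +
      (law V μ₀ μ₁).real ({ω | false ∈ A ω} ∩ {ω | ω.1 = s}) = 1 / 2 := by
  have h := law_real_inter_state μ₀ μ₁ V .univ s
  simp only [Set.univ_inter, Set.preimage_univ, probReal_univ, mul_one] at h
  rw [← h, ← measureReal_union_add_inter ((hA.measurableSet false).inter (measurableSet_state s))]
  have h0 : (law V μ₀ μ₁).real ({ω | true ∈ A ω} ∩ {ω | ω.1 = s} ∩
      ({ω | false ∈ A ω} ∩ {ω | ω.1 = s})) = 0 := by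
    rw [measureReal_def, measure_mono_null (Set.inter_subset_inter Set.inter_subset_left
      Set.inter_subset_left) hu, ENNReal.toReal_zero]
  rw [h0, add_zero]
  refine measureReal_congr ?_
  obtain ⟨i⟩ := ‹Nonempty V›
  filter_upwards [hA.2] with ω hω
  have hor := exists_mem_limitActions μ₀ μ₁ τ G i ω true
  rw [hω i] at hor
  refine propext ?_
  change (true ∈ A ω ∧ ω.1 = s) ∨ (false ∈ A ω ∧ ω.1 = s) ↔ ω.1 = s
  rw [← or_and_right]
  exact and_iff_right hor

end Infinite

/-! ### A graph compared with its limits at infinity -/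

section LimitGraph

variable {V V' : Type*} {Ω : Type*} [MeasurableSpace Ω]
variable (μ₀ μ₁ : Measure Ω) [IsProbabilityMeasure μ₀] [IsProbabilityMeasure μ₁] (τ : TieRule Ω)

/-- The event that agent `i` takes the action `a` at time `t` and has a signal in `B`. -/
def actionEvent (G : SimpleGraph V) [G.LocallyFinite] (t : ℕ) (i : V) (a : Bool) (B : Set Ω) :
    Set (World V Ω) :=
  {ω | action μ₀ μ₁ τ G t i ω = a} ∩ {ω | ω.2 i ∈ B}

lemma measurableSet_actionEvent_limitInfo (G : SimpleGraph V) [G.LocallyFinite] (t : ℕ) (i : V)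
    (a : Bool) {B : Set Ω} (hB : MeasurableSet B) :
    MeasurableSet[limitInfo μ₀ μ₁ τ G i] (actionEvent μ₀ μ₁ τ G t i a B) :=
  (measurable_action_limitInfo μ₀ μ₁ τ G t (Set.mem_insert i _) (measurableSet_singleton a)).inter
    (measurable_signal_limitInfo μ₀ μ₁ τ G i hB)

lemma measurableSet_actionEvent (G : SimpleGraph V) [G.LocallyFinite] (t : ℕ) (i : V)
    (a : Bool) {B : Set Ω} (hB : MeasurableSet B) :
    MeasurableSet (actionEvent μ₀ μ₁ τ G t i a B) :=
  limitInfo_le μ₀ μ₁ τ G i _ (measurableSet_actionEvent_limitInfo μ₀ μ₁ τ G t i a hB)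

lemma actionEvent_ae_eq_of_deep {G : SimpleGraph V} [G.LocallyFinite]
    {G' : SimpleGraph V'} {K : Set V'} [(G'.induce K).LocallyFinite] {e : V' → V}
    (he : Set.InjOn e K) (hN : ∀ c ∈ K, G.neighborSet (e c) = e '' G'.neighborSet c) {t : ℕ}
    {c : V'} (hc : Deep G' K (t + 1) c) (a : Bool) (B : Set Ω) :
    actionEvent μ₀ μ₁ τ G t (e c) a B =ᵐ[law V μ₀ μ₁] pull (fun k : K => e k) ⁻¹'
      actionEvent μ₀ μ₁ τ (G'.induce K) t ⟨c, hc.mem⟩ a B := by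
  filter_upwards [action_ae_eq_of_deep μ₀ μ₁ τ he hN hc] with ω hω
  refine propext ?_
  change (action μ₀ μ₁ τ G t (e c) ω = a ∧ _) ↔ ((action μ₀ μ₁ τ _ _ _ (pull _ ω)) = a ∧ _)
  rw [hω]
  rfl

lemma law_real_actionEvent_of_deep {G : SimpleGraph V} [G.LocallyFinite]
    {G' : SimpleGraph V'} {K : Set V'} [(G'.induce K).LocallyFinite] {e : V' → V}
    (he : Set.InjOn e K) (hN : ∀ c ∈ K, G.neighborSet (e c) = e '' G'.neighborSet c) {t : ℕ}
    {c : V'} (hc : Deep G' K (t + 1) c) (a : Bool) {B : Set Ω} (hB : MeasurableSet B) (s : Bool) :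
    (law V μ₀ μ₁).real (actionEvent μ₀ μ₁ τ G t (e c) a B ∩ {ω | ω.1 = s}) =
      (law K μ₀ μ₁).real (actionEvent μ₀ μ₁ τ (G'.induce K) t ⟨c, hc.mem⟩ a B ∩
        {ω | ω.1 = s}) := by
  refine (measureReal_congr
    ((actionEvent_ae_eq_of_deep μ₀ μ₁ τ he hN hc a B).inter (ae_eq_refl _))).trans ?_
  rw [← (measurePreserving_pull μ₀ μ₁ he.injective).measureReal_preimage
      ((measurableSet_actionEvent μ₀ μ₁ τ _ t _ a hB).inter
        (measurableSet_state s)).nullMeasurableSet]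
  rfl

lemma law_real_actionEvent_induce {G' : SimpleGraph V'} [G'.LocallyFinite] {K : Set V'}
    [(G'.induce K).LocallyFinite] {t : ℕ}
    {c : V'} (hc : Deep G' K (t + 1) c) (a : Bool) {B : Set Ω} (hB : MeasurableSet B) (s : Bool) :
    (law V' μ₀ μ₁).real (actionEvent μ₀ μ₁ τ G' t c a B ∩ {ω | ω.1 = s}) =
      (law K μ₀ μ₁).real (actionEvent μ₀ μ₁ τ (G'.induce K) t ⟨c, hc.mem⟩ a B ∩
        {ω | ω.1 = s}) :=
  law_real_actionEvent_of_deep μ₀ μ₁ τ (e := id) Function.injective_id.injOn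
    (fun _ _ => (Set.image_id _).symm) hc a hB s

/-- The joint law of the state and of the action of an agent in a sequence of graphs is eventually
the same as in their local limit. -/
lemma IsLocalLimit.eventually_law_real_action {l : Filter ℕ} {V : ℕ → Type*}
    {G : ∀ n, SimpleGraph (V n)} [∀ n, (G n).LocallyFinite] {G' : SimpleGraph V'}
    [G'.LocallyFinite] {e : ∀ n, V' → V n} (h : IsLocalLimit l G G' e) (j : V') (t : ℕ)
    (a s : Bool) :
    ∀ᶠ n in l, (law (V n) μ₀ μ₁).real
        ({ω | action μ₀ μ₁ τ (G n) t (e n j) ω = a} ∩ {ω | ω.1 = s}) =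
      (law V' μ₀ μ₁).real ({ω | action μ₀ μ₁ τ G' t j ω = a} ∩ {ω | ω.1 = s}) := by
  obtain ⟨K, hK, hd⟩ := exists_finite_deep G' (t + 1) j
  have := hK.to_subtype
  have : (G'.induce K).LocallyFinite := fun _ => Fintype.ofFinite _
  filter_upwards [h.eventually_on hK] with n hn
  have h1 := law_real_actionEvent_of_deep μ₀ μ₁ τ hn.1 hn.2 hd a .univ s
  rw [← law_real_actionEvent_induce μ₀ μ₁ τ hd a .univ s] at h1
  simpa [actionEvent] using h1

variable {μ₀ μ₁ τ} {G : SimpleGraph V} [G.LocallyFinite] {A : World V Ω → Set Bool}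
variable {G' : SimpleGraph V'} [G'.LocallyFinite] {A' : World V' Ω → Set Bool}

/-- The common limit on `G` is optimal in comparison with the actions in a limit of `G` at
infinity. -/
lemma IsCommonLimit.law_real_mul_actionEvent_le (hA : IsCommonLimit μ₀ μ₁ τ G A) {l : Filter ℕ}
    [l.NeBot] {e : ℕ → V' → V} (he : IsLocalLimit l (fun _ => G) G' e)
    (hesc : ∀ v x, ∀ᶠ n in l, e n v ≠ x) (t : ℕ) (j : V') (a a' : Bool) {B : Set Ω}
    (hB : MeasurableSet B) :
    (law V μ₀ μ₁).real ({ω | a ∈ A ω} ∩ {ω | ω.1 = !a}) *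
        (law V' μ₀ μ₁).real (actionEvent μ₀ μ₁ τ G' t j a' B ∩ {ω | ω.1 = !a}) ≤
      (law V μ₀ μ₁).real ({ω | a ∈ A ω} ∩ {ω | ω.1 = a}) *
        (law V' μ₀ μ₁).real (actionEvent μ₀ μ₁ τ G' t j a' B ∩ {ω | ω.1 = a}) := by
  obtain ⟨K, hK, hd⟩ := exists_finite_deep G' (t + 1) j
  have := hK.to_subtype
  have : (G'.induce K).LocallyFinite := fun _ => Fintype.ofFinite _
  have hev := he.eventually_on hK
  set D := actionEvent μ₀ μ₁ τ (G'.induce K) t ⟨j, hd.mem⟩ a' B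
  -- The event around `e n j` lives on finitely many escaping agents, so it decouples from the
  -- common limit given the state. For each large `n`, agent `e n j` observes it, and optimality of
  -- the common limit applies.
  have ht (s : Bool) := tendsto_law_real_inter_pull μ₀ μ₁ (e := fun n (k : K) => e n k)
    (hev.mono fun n hn => hn.1.injective) (fun k x => hesc k x)
    (measurableSet_actionEvent μ₀ μ₁ τ (G'.induce K) t ⟨j, hd.mem⟩ a' hB) (hA.measurableSet a) s
  have hle := le_of_tendsto_of_tendsto (ht (!a)) (ht a) (by
    filter_upwards [hev] with n hn
    have hae := actionEvent_ae_eq_of_deep μ₀ μ₁ τ hn.1 hn.2 hd a' B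
    have heq (s : Bool) : (law V μ₀ μ₁).real ({ω | a ∈ A ω} ∩ pull (fun k : K => e n k) ⁻¹' D ∩
        {ω | ω.1 = s}) = (law V μ₀ μ₁).real (actionEvent μ₀ μ₁ τ G t (e n j) a' B ∩
          {ω | a ∈ A ω} ∩ {ω | ω.1 = s}) := by
      rw [Set.inter_comm {ω | a ∈ A ω}]
      exact (measureReal_congr ((hae.inter (ae_eq_refl _)).inter (ae_eq_refl _))).symm
    rw [heq, heq]
    exact hA.law_real_le (e n j)
      (measurableSet_actionEvent_limitInfo μ₀ μ₁ τ G t (e n j) a' hB) a)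
  rw [law_real_actionEvent_induce μ₀ μ₁ τ hd a' hB, law_real_actionEvent_induce μ₀ μ₁ τ hd a' hB]
  linarith

/-- The common limits on `G` and on a limit of `G` at infinity, together with a far away signal. -/
lemma IsCommonLimit.law_real_mul_law_real_mul_le [Infinite V'] (hA : IsCommonLimit μ₀ μ₁ τ G A)
    (hA' : IsCommonLimit μ₀ μ₁ τ G' A') (hne : μ₀ ≠ μ₁) {l : Filter ℕ}
    [l.NeBot] {e : ℕ → V' → V} (he : IsLocalLimit l (fun _ => G) G' e)
    (hesc : ∀ v x, ∀ᶠ n in l, e n v ≠ x) (a a' : Bool) {B : Set Ω} (hB : MeasurableSet B) :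
    (law V μ₀ μ₁).real ({ω | a ∈ A ω} ∩ {ω | ω.1 = !a}) *
        ((law V' μ₀ μ₁).real ({ω | a' ∈ A' ω} ∩ {ω | ω.1 = !a}) *
          (signalLaw μ₀ μ₁ (!a)).real B) ≤
      (law V μ₀ μ₁).real ({ω | a ∈ A ω} ∩ {ω | ω.1 = a}) *
        ((law V' μ₀ μ₁).real ({ω | a' ∈ A' ω} ∩ {ω | ω.1 = a}) *
          (signalLaw μ₀ μ₁ a).real B) := by
  have hu := hA'.law_undecided hne
  have h (j : V') : (law V μ₀ μ₁).real ({ω | a ∈ A ω} ∩ {ω | ω.1 = !a}) *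
        (law V' μ₀ μ₁).real ({ω | a' ∈ A' ω} ∩ {ω | ω.2 j ∈ B} ∩ {ω | ω.1 = !a}) ≤
      (law V μ₀ μ₁).real ({ω | a ∈ A ω} ∩ {ω | ω.1 = a}) *
        (law V' μ₀ μ₁).real ({ω | a' ∈ A' ω} ∩ {ω | ω.2 j ∈ B} ∩ {ω | ω.1 = a}) := by
    have hm : MeasurableSet {ω : World V' Ω | ω.2 j ∈ B} :=
      limitInfo_le μ₀ μ₁ τ G' j _ (measurableSet_signal_limitInfo τ G' j hB)
    have ht (s : Bool) := hA'.tendsto_law_real_action hu j a' (hm.inter (measurableSet_state s))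
    simp only [Set.inter_assoc]
    -- Letting `t` grow, after `n` has already been sent to infinity, replaces the action of `j` by
    -- the common limit of `G'`.
    refine le_of_tendsto_of_tendsto' ((ht (!a)).const_mul _) ((ht a).const_mul _) fun t => ?_
    have := hA.law_real_mul_actionEvent_le he hesc t j a a' hB
    simpa only [actionEvent, Set.inter_assoc] using this
  -- Now `j` itself escapes in `G'`, so that its signal decouples from `A'` as well.
  obtain ⟨v, hv⟩ := exists_seq_escaping V'
  have ht (s : Bool) := tendsto_law_real_inter_signal μ₀ μ₁ hv hB (hA'.measurableSet a') s
  exact le_of_tendsto_of_tendsto' ((ht (!a)).const_mul _) ((ht a).const_mul _) fun n => h (v n)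

/-- Unless the agents on `G` learn the state, the agents on a limit of `G` at infinity are less
likely to be correct. -/
theorem IsCommonLimit.law_real_lt [Infinite V] [Infinite V'] (hA : IsCommonLimit μ₀ μ₁ τ G A)
    (hA' : IsCommonLimit μ₀ μ₁ τ G' A') (hne : μ₀ ≠ μ₁) {l : Filter ℕ}
    [l.NeBot] {e : ℕ → V' → V} (he : IsLocalLimit l (fun _ => G) G' e)
    (hesc : ∀ v x, ∀ᶠ n in l, e n v ≠ x) (hlt : (law V μ₀ μ₁).real {ω | A ω = {ω.1}} < 1) :
    (law V' μ₀ μ₁).real {ω | A' ω = {ω.1}} < (law V μ₀ μ₁).real {ω | A ω = {ω.1}} := by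
  have hu := hA.law_undecided hne
  have hu' := hA'.law_undecided hne
  have hp := hA.one_sub_law_real
  have hp' := hA'.one_sub_law_real
  have hs := hA.law_real_add_eq_half hu
  have hs' := hA'.law_real_add_eq_half hu'
  have hsig := hA.law_real_mul_signalLaw_le
  have hkey := hA.law_real_mul_law_real_mul_le hA' hne he hesc
  obtain ⟨B, hB, hBlt⟩ := exists_measureReal_lt hne
  obtain ⟨C, hC, hClt⟩ := exists_measureReal_lt hne.symm
  have hT := hs true
  have hF := hs false
  have hT' := hs' true
  have hF' := hs' false
  have hsT := hsig true .univ
  have hsTC := hsig true hC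
  have hsFB := hsig false hB
  have hkT := hkey true false .univ
  have hkTC := hkey true false hC
  have hkF := hkey false true .univ
  have hkFB := hkey false true hB
  simp only [Bool.not_true, Bool.not_false, signalLaw_true, signalLaw_false, probReal_univ,
    mul_one] at *
  have hpos (a s : Bool) : 0 ≤ (law V μ₀ μ₁).real ({ω | a ∈ A ω} ∩ {ω | ω.1 = s}) :=
    measureReal_nonneg
  have hpos' (a s : Bool) : 0 ≤ (law V' μ₀ μ₁).real ({ω | a ∈ A' ω} ∩ {ω | ω.1 = s}) :=
    measureReal_nonneg
  have h1 := hpos true true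
  have h2 := hpos true false
  have h3 := hpos false true
  have h4 := hpos false false
  have h5 := hpos' true true
  have h6 := hpos' true false
  have h7 := hpos' false true
  have h8 := hpos' false false
  clear hsig hkey hs hs' hpos hpos'
  generalize (law V μ₀ μ₁).real {ω | A ω = {ω.1}} = p at *
  generalize (law V' μ₀ μ₁).real {ω | A' ω = {ω.1}} = p' at *
  generalize (law V μ₀ μ₁).real ({ω | true ∈ A ω} ∩ {ω | ω.1 = true}) = x₁₁ at *
  generalize (law V μ₀ μ₁).real ({ω | true ∈ A ω} ∩ {ω | ω.1 = false}) = x₁₀ at *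
  generalize (law V μ₀ μ₁).real ({ω | false ∈ A ω} ∩ {ω | ω.1 = true}) = x₀₁ at *
  generalize (law V μ₀ μ₁).real ({ω | false ∈ A ω} ∩ {ω | ω.1 = false}) = x₀₀ at *
  generalize (law V' μ₀ μ₁).real ({ω | true ∈ A' ω} ∩ {ω | ω.1 = true}) = y₁₁ at *
  generalize (law V' μ₀ μ₁).real ({ω | true ∈ A' ω} ∩ {ω | ω.1 = false}) = y₁₀ at *
  generalize (law V' μ₀ μ₁).real ({ω | false ∈ A' ω} ∩ {ω | ω.1 = true}) = y₀₁ at *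
  generalize (law V' μ₀ μ₁).real ({ω | false ∈ A' ω} ∩ {ω | ω.1 = false}) = y₀₀ at *
  by_contra! hle
  have hx₀₁ : x₀₁ = 1 / 2 - x₁₁ := by linarith
  have hx₀₀ : x₀₀ = 1 / 2 - x₁₀ := by linarith
  have hy₀₁ : y₀₁ = 1 / 2 - y₁₁ := by linarith
  have hy₀₀ : y₀₀ = 1 / 2 - y₁₀ := by linarith
  -- The bracketed terms compare the states when the two limits disagree. By `hkT` and `hkF` both
  -- gaps are nonnegative; if `p ≤ p'`, their sum is nonpositive, so both vanish.
  have hsum : x₁₁ * y₀₁ + x₀₀ * y₁₀ - (x₁₀ * y₀₀ + x₀₁ * y₁₁) = 1 / 2 * (p - p') := by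
    have e1 : p = 1 - (x₀₁ + x₁₀) := by linarith
    have e2 : p' = 1 - (y₀₁ + y₁₀) := by linarith
    rw [e1, e2, hx₀₁, hx₀₀, hy₀₁, hy₀₀]
    ring
  have hz₁ : x₁₀ * y₀₀ = x₁₁ * y₀₁ := by linarith
  have hz₂ : x₀₁ * y₁₁ = x₀₀ * y₁₀ := by linarith
  -- With the states exactly balanced, an independent signal in `C`, which favours state 0, would
  -- tip optimality against action 1 unless the mass is zero. For `hw₂`, the signal set `B` plays
  -- the symmetric role.
  have hw₁ : x₁₁ * y₀₁ = 0 := by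
    have := mul_nonneg h1 h7
    have h : (x₁₁ * y₀₁) * (μ₀.real C - μ₁.real C) ≤ 0 := by
      rw [mul_sub]; nth_rewrite 1 [← hz₁]; linarith
    nlinarith
  have hw₂ : x₀₀ * y₁₀ = 0 := by
    have := mul_nonneg h4 h6
    have h : (x₀₀ * y₁₀) * (μ₁.real B - μ₀.real B) ≤ 0 := by
      rw [mul_sub]; nth_rewrite 1 [← hz₂]; linarith
    nlinarith
  rw [hw₁] at hz₁
  rw [hw₂] at hz₂
  have hcase₁ : x₁₁ = 0 ∨ x₁₁ = 1 / 2 := by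
    rcases mul_eq_zero.1 hw₁ with h | h
    · exact Or.inl h
    · rcases mul_eq_zero.1 hz₂ with h' | h' <;> [right; exfalso] <;> linarith
  have hcase₀ : x₁₀ = 0 ∨ x₁₀ = 1 / 2 := by
    rcases mul_eq_zero.1 hz₁ with h | h
    · exact Or.inl h
    · rcases mul_eq_zero.1 hw₂ with h' | h' <;> [right; exfalso] <;> linarith
  -- In each state the limit action is now deterministic. A constant action contradicts a distant
  -- signal (`hsFB`, `hsTC`), the always wrong one contradicts optimality, and the always correct
  -- one contradicts `hlt`.
  rcases hcase₁ with h | h <;> rcases hcase₀ with h' | h'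
  · rw [show x₀₁ = 1 / 2 by linarith, show x₀₀ = 1 / 2 by linarith] at hsFB
    linarith
  · linarith
  · linarith
  · rw [h, h'] at hsTC
    linarith

end LimitGraph

/-! ### Learning from many neighbours -/

section HighDegree

variable {V : Type*} {Ω : Type*} [MeasurableSpace Ω]

/-- The weak law of large numbers for independent random variables with values in `[0, 1]`. -/
lemma infinitePi_real_sum_deviation_le {μ : Measure Ω} [IsProbabilityMeasure μ] (N : Finset V)
    {f : V → Ω → ℝ} (hf : ∀ j, Measurable (f j)) (h01 : ∀ j x, f j x ∈ Set.Icc (0 : ℝ) 1) {c : ℝ}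
    (hc : 0 < c) :
    (Measure.infinitePi fun _ : V => μ).real
      {w | c ≤ |∑ j ∈ N, f j (w j) - ∑ j ∈ N, ∫ x, f j x ∂μ|} ≤ N.card / c ^ 2 := by
  set ν := Measure.infinitePi fun _ : V => μ
  let X : V → (V → Ω) → ℝ := fun j w => f j (w j)
  have hXm (j : V) : Measurable (X j) := (hf j).comp (measurable_pi_apply j)
  have hXb (j : V) : ∀ᵐ w ∂ν, X j w ∈ Set.Icc (0 : ℝ) 1 :=
    Eventually.of_forall fun w => h01 j (w j)
  have hX (j : V) : MemLp (X j) 2 ν := memLp_of_bounded (hXb j) (hXm j).aestronglyMeasurable 2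
  have hind : iIndepFun X ν := iIndepFun_infinitePi (P := fun _ : V => μ) (X := f) hf
  have hvar : variance (∑ j ∈ N, X j) ν ≤ N.card := by
    rw [IndepFun.variance_sum (fun j _ => hX j) fun i _ j _ hij => hind.indepFun hij]
    refine (Finset.sum_le_card_nsmul N _ 1 fun j _ => ?_).trans (by simp)
    exact (variance_le_sq_of_bounded (hXb j) (hXm j).aemeasurable).trans (by norm_num)
  have hmean : ν[∑ j ∈ N, X j] = ∑ j ∈ N, ∫ x, f j x ∂μ := by
    simp only [Finset.sum_apply]
    rw [integral_finsetSum _ fun j _ => (hX j).integrable (by norm_num)]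
    refine Finset.sum_congr rfl fun j _ => ?_
    have h := (measurePreserving_eval_infinitePi (fun _ : V => μ) j)
    rw [← h.map_eq, integral_map h.aemeasurable
      (by rw [h.map_eq]; exact (hf j).aestronglyMeasurable)]
  have h := meas_ge_le_variance_div_sq (memLp_finsetSum' N fun j _ => hX j) hc (μ := ν)
  rw [hmean] at h
  simp only [Finset.sum_apply] at h
  refine (ENNReal.toReal_mono ENNReal.ofReal_ne_top h).trans ?_
  rw [ENNReal.toReal_ofReal (div_nonneg (variance_nonneg _ _) (sq_nonneg c))]
  gcongr

variable {μ₀ μ₁ : Measure Ω} [IsProbabilityMeasure μ₀] [IsProbabilityMeasure μ₁]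

/-- At time 0 all histories are empty, leaving only the private signal. The function `h` depends on
the agent, as the tie rule sees the number of neighbours. -/
lemma exists_action_zero_eq (τ : TieRule Ω) (G : SimpleGraph V) [G.LocallyFinite] (j : V) :
    ∃ h : Ω → Bool, Measurable h ∧ ∀ ω, action μ₀ μ₁ τ G 0 j ω = h (ω.2 j) := by
  have hm := measurable_bestAction μ₀ μ₁ τ G (history μ₀ μ₁ τ G 0) j
  have hle : info G (history μ₀ μ₁ τ G 0) j ≤
      MeasurableSpace.comap (fun ω : World V Ω => ω.2 j) inferInstance := by
    refine sup_le le_rfl (iSup₂_le fun i _ => ?_)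
    exact Measurable.comap_le (measurable_const (a := ([] : List Bool)))
  obtain ⟨h, hh, heq⟩ := (hm.mono hle le_rfl).exists_eq_measurable_comp
  exact ⟨h, hh, fun ω => congrFun heq ω⟩

/-- The first action of an agent distinguishes the two states at least as well as any event. -/
lemma measureReal_action_zero_gap {τ : TieRule Ω} {G : SimpleGraph V} [G.LocallyFinite] {j : V}
    {h : Ω → Bool} (hh : Measurable h) (heq : ∀ ω, action μ₀ μ₁ τ G 0 j ω = h (ω.2 j))
    {B : Set Ω} (hB : MeasurableSet B) :
    μ₁.real B - μ₀.real B ≤ μ₁.real (h ⁻¹' {true}) - μ₀.real (h ⁻¹' {true}) := by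
  -- As in the Neyman–Pearson lemma, passing from `B` to the event that action 1 is taken adds a
  -- part where `μ₁` dominates and removes a part where `μ₀` dominates.
  have key (a : Bool) {C : Set Ω} (hC : MeasurableSet C) :
      (signalLaw μ₀ μ₁ (!a)).real (C ∩ h ⁻¹' {a}) ≤ (signalLaw μ₀ μ₁ a).real (C ∩ h ⁻¹' {a}) := by
    have hopt := law_real_action_le μ₀ μ₁ τ G 0 j (D := {ω | ω.2 j ∈ C})
      (measurable_signal_info G _ j hC) a
    have hset : {ω : World V Ω | ω.2 j ∈ C} ∩ {ω | action μ₀ μ₁ τ G 0 j ω = a} =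
        {ω | ω.2 j ∈ C ∩ h ⁻¹' {a}} := by
      ext ω
      simp [heq]
    have hm := hC.inter (hh (measurableSet_singleton a))
    rw [hset, law_real_signal_mem μ₀ μ₁ j hm, law_real_signal_mem μ₀ μ₁ j hm] at hopt
    linarith
  have h1 := key true hB.compl
  have h2 := key false hB
  simp only [Bool.not_true, Bool.not_false, signalLaw_true, signalLaw_false] at h1 h2
  have hm := hh (measurableSet_singleton true)
  have hsplit (μ : Measure Ω) [IsProbabilityMeasure μ] : μ.real (h ⁻¹' {true}) =
      μ.real (Bᶜ ∩ h ⁻¹' {true}) + (μ.real B - μ.real (B ∩ h ⁻¹' {false})) := by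
    have e1 := measureReal_inter_add_sdiff hB (s := h ⁻¹' {true}) (μ := μ)
    have e2 := measureReal_inter_add_sdiff hm (s := B) (μ := μ)
    have e3 : h ⁻¹' {true} \ B = Bᶜ ∩ h ⁻¹' {true} := by ext x; simp [and_comm]
    have e4 : B \ h ⁻¹' {true} = B ∩ h ⁻¹' {false} := by ext x; simp
    rw [e3, Set.inter_comm _ B] at e1
    rw [e4] at e2
    linarith
  rw [hsplit μ₀, hsplit μ₁]
  linarith

/-- An agent with many neighbours learns the state from their first actions. -/
theorem IsCommonLimit.one_sub_law_real_le_of_degree {τ : TieRule Ω} {G : SimpleGraph V}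
    [G.LocallyFinite] {A : World V Ω → Set Bool} (hA : IsCommonLimit μ₀ μ₁ τ G A) {B : Set Ω}
    (hB : MeasurableSet B) (hlt : μ₀.real B < μ₁.real B) (i : V) (hpos : 0 < G.degree i) :
    1 - (law V μ₀ μ₁).real {ω | A ω = {ω.1}} ≤
      8 / ((μ₁.real B - μ₀.real B) ^ 2 * G.degree i) := by
  choose h hh heq using exists_action_zero_eq (μ₀ := μ₀) (μ₁ := μ₁) τ G
  set δ := μ₁.real B - μ₀.real B with hδ
  set N := G.neighborFinset i with hN
  have hm : (0 : ℝ) < N.card := by exact_mod_cast hpos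
  let f : V → Ω → ℝ := fun j x => if h j x = true then 1 else 0
  have hf (j : V) : Measurable (f j) :=
    Measurable.ite (hh j (measurableSet_singleton true)) measurable_const measurable_const
  have h01 (j : V) (x : Ω) : f j x ∈ Set.Icc (0 : ℝ) 1 := by
    simp only [f]
    split_ifs <;> simp
  have hint (μ : Measure Ω) [IsProbabilityMeasure μ] (j : V) :
      ∫ x, f j x ∂μ = μ.real (h j ⁻¹' {true}) := by
    rw [← integral_indicator_one (hh j (measurableSet_singleton true))]
    congr 1 with x
    by_cases hx : h j x = true <;> simp [f, hx]
  let M : Bool → ℝ := fun s => ∑ j ∈ N, ∫ x, f j x ∂(signalLaw μ₀ μ₁ s)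
  have hgap : N.card * δ ≤ M true - M false := by
    simp only [M, ← Finset.sum_sub_distrib]
    rw [← nsmul_eq_mul]
    refine Finset.card_nsmul_le_sum N _ δ fun j _ => ?_
    rw [hint, hint]
    exact measureReal_action_zero_gap (hh j) (heq j) hB
  -- The test counts the first actions equal to 1 and cuts halfway between the two conditional
  -- means. These are at least `N.card * δ` apart, so an error means a deviation of at least `N.card
  -- * δ / 2`.
  let D : Set (World V Ω) := {ω | (M true + M false) / 2 < ∑ j ∈ N, f j (ω.2 j)}
  have hD : MeasurableSet[limitInfo μ₀ μ₁ τ G i] D := by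
    refine measurableSet_lt measurable_const (Finset.measurable_sum N fun j hj => ?_)
    have hact := measurable_action_limitInfo μ₀ μ₁ τ G 0 (i := i) (j := j)
      (Set.mem_insert_of_mem _ (by simpa [N] using hj))
    have hfa : (fun ω : World V Ω => f j (ω.2 j)) =
        fun ω => if action μ₀ μ₁ τ G 0 j ω = true then 1 else 0 := by
      ext ω
      simp [f, heq]
    rw [hfa]
    exact Measurable.ite (hact (measurableSet_singleton true)) measurable_const measurable_const
  have hDm : MeasurableSet D := limitInfo_le μ₀ μ₁ τ G i D hD
  have hδpos : 0 < δ := sub_pos.2 hlt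
  have hc : 0 < N.card * δ / 2 := by positivity
  have hdev (s : Bool) : (signalsLaw μ₀ μ₁ V s).real
      {w | N.card * δ / 2 ≤ |∑ j ∈ N, f j (w j) - M s|} ≤ 4 / (δ ^ 2 * N.card) := by
    refine (infinitePi_real_sum_deviation_le N hf h01 hc).trans (le_of_eq ?_)
    field_simp
    ring
  have hfin := hA.one_sub_law_real_le i hD
  rw [law_real_inter_state μ₀ μ₁ V hDm, law_real_inter_state μ₀ μ₁ V hDm.compl] at hfin
  have h0 : (signalsLaw μ₀ μ₁ V false).real (Prod.mk false ⁻¹' D) ≤ 4 / (δ ^ 2 * N.card) := by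
    refine le_trans (measureReal_mono fun w hw => ?_) (hdev false)
    have hw' : (M true + M false) / 2 < ∑ j ∈ N, f j (w j) := hw
    have hle : N.card * δ / 2 ≤ ∑ j ∈ N, f j (w j) - M false := by linarith
    exact hle.trans (le_abs_self _)
  have h1 : (signalsLaw μ₀ μ₁ V true).real (Prod.mk true ⁻¹' Dᶜ) ≤ 4 / (δ ^ 2 * N.card) := by
    refine le_trans (measureReal_mono fun w hw => ?_) (hdev true)
    have hw' : ∑ j ∈ N, f j (w j) ≤ (M true + M false) / 2 := not_lt.1 hw
    have hle : N.card * δ / 2 ≤ -(∑ j ∈ N, f j (w j) - M true) := by linarith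
    exact hle.trans (neg_le_abs _)
  have h8 : 8 / (δ ^ 2 * G.degree i) = 2 * (4 / (δ ^ 2 * N.card)) := by
    rw [hN, SimpleGraph.card_neighborFinset_eq_degree]
    ring
  rw [h8]
  linarith

end HighDegree

/-! ### Minimisation over infinite graphs and conclusion -/

section Learning

variable {Ω : Type*} [MeasurableSpace Ω]
variable {μ₀ μ₁ : Measure Ω} [IsProbabilityMeasure μ₀] [IsProbabilityMeasure μ₁] {τ : TieRule Ω}

lemma law_real_action_eq_state {V : Type*} (G : SimpleGraph V) [G.LocallyFinite] (t : ℕ) (i : V) :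
    (law V μ₀ μ₁).real {ω | action μ₀ μ₁ τ G t i ω = ω.1} =
      (law V μ₀ μ₁).real ({ω | action μ₀ μ₁ τ G t i ω = true} ∩ {ω | ω.1 = true}) +
      (law V μ₀ μ₁).real ({ω | action μ₀ μ₁ τ G t i ω = false} ∩ {ω | ω.1 = false}) := by
  rw [law_real_eq_add μ₀ μ₁ V _ true]
  congr 2 <;> ext ω <;> simp only [Set.mem_inter_iff, Set.mem_ofPred_eq] <;>
    cases ω.1 <;> simp

/-- The probability of being correct is lower semicontinuous under local limits. -/
lemma IsLocalLimit.law_real_le {l : Filter ℕ} [l.NeBot] {V : ℕ → Type*}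
    {G : ∀ n, SimpleGraph (V n)} [∀ n, (G n).LocallyFinite] {V' : Type*} [Infinite V']
    {G' : SimpleGraph V'} [G'.LocallyFinite] {e : ∀ n, V' → V n} (h : IsLocalLimit l G G' e)
    {A' : World V' Ω → Set Bool} (hA' : IsCommonLimit μ₀ μ₁ τ G' A') (hne : μ₀ ≠ μ₁)
    {b : ℕ → ℝ} {b₀ : ℝ} (hb : Tendsto b l (𝓝 b₀))
    (hle : ∀ n t i, (law (V n) μ₀ μ₁).real {ω | action μ₀ μ₁ τ (G n) t i ω = ω.1} ≤ b n) :
    (law V' μ₀ μ₁).real {ω | A' ω = {ω.1}} ≤ b₀ := by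
  obtain ⟨r⟩ : Nonempty V' := inferInstance
  have hu := hA'.law_undecided hne
  have ht : Tendsto (fun t => (law V' μ₀ μ₁).real {ω | action μ₀ μ₁ τ G' t r ω = ω.1}) atTop
      (𝓝 ((law V' μ₀ μ₁).real {ω | A' ω = {ω.1}})) := by
    have hsum : (law V' μ₀ μ₁).real {ω | A' ω = {ω.1}} =
        (law V' μ₀ μ₁).real ({ω | true ∈ A' ω} ∩ {ω | ω.1 = true}) +
        (law V' μ₀ μ₁).real ({ω | false ∈ A' ω} ∩ {ω | ω.1 = false}) := by
      have h1 := hA'.one_sub_law_real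
      have h2 := hA'.law_real_add_eq_half hu true
      have h3 := hA'.law_real_add_eq_half hu false
      linarith
    simp only [law_real_action_eq_state]
    rw [hsum]
    exact (hA'.tendsto_law_real_action hu r true (measurableSet_state true)).add
      (hA'.tendsto_law_real_action hu r false (measurableSet_state false))
  -- At a fixed time the accuracy on `G'` coincides with that on `G n` for `l`-almost all `n`. Only
  -- afterwards does `t` grow, which gives a one-sided bound.
  refine le_of_tendsto' ht fun t => ge_of_tendsto hb ?_
  filter_upwards [h.eventually_law_real_action μ₀ μ₁ τ r t true true,
    h.eventually_law_real_action μ₀ μ₁ τ r t false false] with n h1 h2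
  rw [law_real_action_eq_state, ← h1, ← h2, ← law_real_action_eq_state]
  exact hle n t _

/-- The probabilities that the common limit is correct, on the infinite connected graphs with
degrees at most `d`. -/
def correctProbabilities (μ₀ μ₁ : Measure Ω) [IsProbabilityMeasure μ₀] [IsProbabilityMeasure μ₁]
    (τ : TieRule Ω) (d : ℕ) : Set ℝ :=
  {x | ∃ (V : Type) (_ : Infinite V) (G : SimpleGraph V) (_ : G.LocallyFinite)
    (A : World V Ω → Set Bool), G.Connected ∧ (∀ v, (G.neighborSet v).encard ≤ d) ∧
      IsCommonLimit μ₀ μ₁ τ G A ∧ x = (law V μ₀ μ₁).real {ω | A ω = {ω.1}}}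

/-- A sequence of growing connected graphs of bounded degree has an infinite local limit, on which
the agents are at most as likely to be correct. -/
lemma exists_isLocalLimit_isCommonLimit (hagree : GuaranteesAgreement μ₀ μ₁ τ) {V : ℕ → Type}
    (G : ∀ n, SimpleGraph (V n)) (hconn : ∀ n, (G n).Connected) {d : ℕ}
    (hd : ∀ n v, ((G n).neighborSet v).encard ≤ d)
    (hcard : ∀ m : ℕ, ∀ᶠ n in hyperfilter ℕ, (m : ℕ∞) < ENat.card (V n)) (root : ∀ n, V n) :
    ∃ (V' : Type) (_ : Infinite V') (G' : SimpleGraph V') (_ : G'.LocallyFinite)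
      (A' : World V' Ω → Set Bool) (e : ∀ n, V' → V n), G'.Connected ∧
      (∀ v, (G'.neighborSet v).encard ≤ d) ∧ IsCommonLimit μ₀ μ₁ τ G' A' ∧
      IsLocalLimit (hyperfilter ℕ) G G' e ∧ ∃ r, ∀ᶠ n in hyperfilter ℕ, e n r = root n := by
  obtain ⟨V', G', e, _, hinf, hc, hd', hlim, hr⟩ :=
    exists_isLocalLimit (hyperfilter ℕ) G hconn hd hcard root
  have hlf : G'.LocallyFinite := fun v => (Set.finite_of_encard_le_coe (hd' v)).fintype
  obtain ⟨A', hA'⟩ := hagree V' G' hc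
  exact ⟨V', hinf, G', hlf, A', e, hc, hd', hA', hlim, hr⟩

/-- On infinite graphs of bounded degree, the agents learn the state. -/
theorem eq_one_of_mem_correctProbabilities (hagree : GuaranteesAgreement μ₀ μ₁ τ) (hne : μ₀ ≠ μ₁)
    {d : ℕ} {x : ℝ} (hx : x ∈ correctProbabilities μ₀ μ₁ τ d) : x = 1 := by
  have hcorr := hx
  obtain ⟨V, hV, G, hG, A, hc, hd, hA, rfl⟩ := hx
  by_contra hx1
  have hlt : (law V μ₀ μ₁).real {ω | A ω = {ω.1}} < 1 := lt_of_le_of_ne measureReal_le_one hx1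
  have hbdd : BddBelow (correctProbabilities μ₀ μ₁ τ d) :=
    ⟨0, by rintro _ ⟨_, _, _, _, _, _, _, _, rfl⟩; exact measureReal_nonneg⟩
  have hinf_lt := (csInf_le hbdd hcorr).trans_lt hlt
  obtain ⟨b, -, hb, hbmem⟩ := exists_seq_tendsto_sInf ⟨_, hcorr⟩ hbdd
  -- A local limit of a minimising sequence attains the infimum, by lower semicontinuity.
  choose W hW H hH C hHc hHd hC hbC using hbmem
  obtain ⟨V', hV', G', hG', A', e, hc', hd', hA', hlim, -⟩ :=
    exists_isLocalLimit_isCommonLimit hagree H hHc hHd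
      (fun m => Eventually.of_forall fun n => by simp [ENat.card_eq_top_of_infinite])
      (fun n => (hHc n).nonempty.some)
  have hle' : (law V' μ₀ μ₁).real {ω | A' ω = {ω.1}} ≤ sInf (correctProbabilities μ₀ μ₁ τ d) := by
    refine hlim.law_real_le hA' hne (hb.mono_left Nat.hyperfilter_le_atTop) fun n t i => ?_
    rw [hbC]
    exact (hC n).law_real_action_le ((hC n).law_undecided hne) t i
  -- The minimiser is rerooted at vertices tending to infinity; the resulting limit has the same
  -- degree bound and strictly smaller accuracy.
  obtain ⟨v, hv⟩ := exists_seq_escaping V'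
  obtain ⟨V'', hV'', G'', hG'', A'', e', hc'', hd'', hA'', hlim', r, hr⟩ :=
    exists_isLocalLimit_isCommonLimit hagree (fun _ => G') (fun _ => hc') (fun _ => hd')
      (fun m => Eventually.of_forall fun n => by simp [ENat.card_eq_top_of_infinite]) v
  have hesc := hlim'.eventually_ne hc'' (r := r) fun y => by
    filter_upwards [hr, (hv y).filter_mono Nat.hyperfilter_le_atTop] with n h1 h2
    rwa [h1]
  have hdec := hA'.law_real_lt hA'' hne hlim' hesc (hle'.trans_lt hinf_lt)
  have hmem : (law V'' μ₀ μ₁).real {ω | A'' ω = {ω.1}} ∈ correctProbabilities μ₀ μ₁ τ d :=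
    ⟨V'', hV'', G'', hG'', A'', hc'', hd'', hA'', rfl⟩
  linarith [csInf_le hbdd hmem]

/-- On large finite graphs, the agents learn the state. -/
theorem exists_forall_le_law_real (hagree : GuaranteesAgreement μ₀ μ₁ τ) (hne : μ₀ ≠ μ₁) {ε : ℝ}
    (hε : 0 < ε) : ∃ n₀ : ℕ, ∀ (V : Type) [Fintype V] (G : SimpleGraph V) [G.LocallyFinite]
      (A : World V Ω → Set Bool), n₀ ≤ Fintype.card V → G.Connected → IsCommonLimit μ₀ μ₁ τ G A →
        1 - ε ≤ (law V μ₀ μ₁).real {ω | A ω = {ω.1}} := by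
  obtain ⟨B, hB, hlt⟩ := exists_measureReal_lt hne
  have hδ : 0 < μ₁.real B - μ₀.real B := sub_pos.2 hlt
  -- Beyond this degree the error bound for a high-degree agent drops below `ε`.
  obtain ⟨d, hd⟩ := exists_nat_gt (8 / ((μ₁.real B - μ₀.real B) ^ 2 * ε))
  by_contra! hcon
  choose V hV G hG A hcard hc hA hbad using hcon
  have hdeg (n : ℕ) (v : V n) : ((G n).neighborSet v).encard ≤ d := by
    by_contra! hgt
    rw [← SimpleGraph.coe_neighborFinset, Set.encard_coe_eq_coe_finsetCard,
      SimpleGraph.card_neighborFinset_eq_degree] at hgt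
    have hgt' : d < (G n).degree v := by exact_mod_cast hgt
    have hgt'' : (d : ℝ) < (G n).degree v := by exact_mod_cast hgt'
    have h1 := (hA n).one_sub_law_real_le_of_degree hB hlt v (by omega)
    have hpos : (0 : ℝ) < (G n).degree v := (Nat.cast_nonneg d).trans_lt hgt''
    have h2 : 8 / ((μ₁.real B - μ₀.real B) ^ 2 * (G n).degree v) < ε := by
      have h3 := hd.trans hgt''
      rw [div_lt_iff₀ (by positivity)] at h3 ⊢
      linarith
    linarith [hbad n]
  obtain ⟨V', hV', G', hG', A', e, hc', hd', hA', hlim, -⟩ :=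
    exists_isLocalLimit_isCommonLimit hagree G hc hdeg
      (fun m => by
        filter_upwards [(eventually_gt_atTop m).filter_mono Nat.hyperfilter_le_atTop] with n hn
        rw [ENat.card_eq_coe_fintype_card]
        exact_mod_cast hn.trans_le (hcard n))
      (fun n => (hc n).nonempty.some)
  have hle : (law V' μ₀ μ₁).real {ω | A' ω = {ω.1}} ≤ 1 - ε / 2 := by
    -- On finite graphs the agents may stay undecided, so only the bound with the factor 2 is
    -- available; it turns `ε` into `ε / 2`.
    refine hlim.law_real_le hA' hne (tendsto_const_nhds (x := 1 - ε / 2)) fun n t i => ?_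
    have h1 := (hA n).one_sub_law_real_le i (measurable_action_limitInfo μ₀ μ₁ τ (G n) t
      (Set.mem_insert i _) (measurableSet_singleton true))
    have h2 := one_sub_law_real_action μ₀ μ₁ τ (G n) t i
    have h3 : 1 - (law (V n) μ₀ μ₁).real {ω | A n ω = {ω.1}} ≤
        2 * (1 - (law (V n) μ₀ μ₁).real {ω | action μ₀ μ₁ τ (G n) t i ω = ω.1}) := by
      rw [h2]; exact h1
    linarith [hbad n]
  have h1 := eq_one_of_mem_correctProbabilities hagree hne (d := d)
    ⟨V', hV', G', hG', A', hc', hd', hA', rfl⟩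
  linarith

end Learning

end SocialLearning

theorem mainTheorem1 {Ω : Type*} [MetricSpace Ω] [CompactSpace Ω] [MeasurableSpace Ω]
    [BorelSpace Ω] (μ₀ μ₁ : Measure Ω) [IsProbabilityMeasure μ₀] [IsProbabilityMeasure μ₁]
    (h₀₁ : μ₀ ≪ μ₁) (h₁₀ : μ₁ ≪ μ₀) (hne : μ₀ ≠ μ₁) (τ : SocialLearning.TieRule Ω)
    (hagree : SocialLearning.GuaranteesAgreement μ₀ μ₁ τ) :
    ∃ q : ℕ → ℝ, Tendsto q atTop (𝓝 1) ∧
      ∀ (n : ℕ) (V : Type) [Fintype V] (G : SimpleGraph V) [G.LocallyFinite],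
        Fintype.card V = n → G.Connected →
          ∀ A : SocialLearning.World V Ω → Set Bool, SocialLearning.IsCommonLimit μ₀ μ₁ τ G A →
            q n ≤ (SocialLearning.law V μ₀ μ₁).real {ω | A ω = {ω.1}} := by
  -- The best possible `q n` is the infimum over all graphs with `n` agents. Inserting 1 keeps the
  -- set nonempty and the infimum at most 1.
  let T : ℕ → Set ℝ := fun n => insert 1 {x | ∃ (V : Type) (_ : Fintype V) (G : SimpleGraph V)
    (_ : G.LocallyFinite) (A : SocialLearning.World V Ω → Set Bool), Fintype.card V = n ∧
      G.Connected ∧ SocialLearning.IsCommonLimit μ₀ μ₁ τ G A ∧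
        x = (SocialLearning.law V μ₀ μ₁).real {ω | A ω = {ω.1}}}
  have hbdd (n : ℕ) : BddBelow (T n) := by
    refine ⟨0, ?_⟩
    rintro _ (rfl | ⟨_, _, _, _, _, _, _, _, rfl⟩)
    · exact zero_le_one
    · exact measureReal_nonneg
  refine ⟨fun n => sInf (T n), ?_, fun n V _ G _ hn hG A hA =>
    csInf_le (hbdd n) (Or.inr ⟨V, _, G, _, A, hn, hG, hA, rfl⟩)⟩
  rw [Metric.tendsto_atTop]
  intro ε hε
  obtain ⟨n₀, h⟩ := SocialLearning.exists_forall_le_law_real hagree hne (half_pos hε)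
  refine ⟨n₀, fun n hn => ?_⟩
  have h1 : sInf (T n) ≤ 1 := csInf_le (hbdd n) (Set.mem_insert _ _)
  have h2 : 1 - ε / 2 ≤ sInf (T n) := by
    refine le_csInf ⟨1, Set.mem_insert _ _⟩ ?_
    rintro _ (rfl | ⟨V, _, G, _, A, hcard, hG, hA, rfl⟩)
    · linarith
    · exact h V G A (hcard ▸ hn) hG hA
  rw [Real.dist_eq, abs_sub_lt_iff]
  constructor <;> linarith
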